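/- **Words.** Let $\phi:\mathbb P^*\to\mathbb P^*$ be Foata's fundamental bijection on words in the positive integers: $\phi(a_1\cdots a_n)=w_n$, where $w_1=a_1$ and $w_{i+1}$ is obtained from $w_i=b_1\cdots b_i$ as follows. If $b_i\le a_{i+1}$ (resp. $b_i>a_{i+1}$), cut $w_i$ after each letter that is $\le a_{i+1}$ (resp. $>a_{i+1}$), cyclically shift each factor so that its last letter comes to the front, and append $a_{i+1}$. For a word $v$ let $W_v=\{1,2\}^*v\cup\{\epsilon\}$ and let $B_v$ be the set of ballot sequences in $W_v$ (words such that, for every $i$, each prefix has at least as many $i$'s as $(i+1)$'s). In a word in $\{1,2\}^*$ pair ones and twos like left and right parentheses. If some two is unpaired, let $\gamma(w)$ be $w$ with its rightmost unpaired two changed to a one. Let $GK(\epsilon)=\epsilon$ and, if $v=x121\in W_{121}$ has $t$ unpaired twos, let $GK(v)=\gamma^t(x)\,1\,2^{t+1}\,1$. For $u=x12^m1$ with $m\ge1$ and $x$ having an unpaired two, let $\bar\gamma(u)=\gamma(x)\,1\,2^{m+1}\,1$. **Partitions.** For a partition $\lambda$ with conjugate $\lambda'$ and Durfee square of side $d(\lambda)$,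 let $r_i(\lambda)=\lambda_i-\lambda_i'$ for $1\le i\le d(\lambda)$ and $r(\lambda)=\max_i r_i(\lambda)$ ($-\infty$ if $\lambda=\emptyset$). Let $D_0=\{\lambda:\lambda_1=\lambda_2\}$ (including $\emptyset$) and $R_{\le-1}=\{\lambda: r_i(\lambda)\le-1\text{ for all }i\}$. Let $w(\lambda)\in\{1,2\}^*$ be the word that records the north steps (as $1$) and east steps (as $2$) along the southeast boundary of the Ferrers diagram of $\lambda$, from southwest to northeast. Let $\kappa(\lambda)$ be the result of the following operation, with $i$ the maximum index such that $r_i(\lambda)=r(\lambda)$: remove a part of size $i$ from $\lambda'$, add a part of size $i-1$ to $\lambda$, and increase $\lambda_1$ by one. ($\kappa(\lambda)$ is undefined if $\lambda'$ has no part of size $i$.) The algorithm $CSV$, on input $\lambda$, replaces $\lambda$ by $\kappa(\lambda)$ while $r(\lambda)\ge0$, and then outputs $\lambda$. **Theorem.** The map $\lambda\mapsto w(\lambda)$ is injective; identify $\lambda$ with $w(\lambda)$. Then $\phi$ restricts to bijections $W_{121}\to D_0$ and $B_{21}\to R_{\le-1}$, the map $GK:W_{121}\to B_{21}$ is a well-defined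 bijection, and on every input $\lambda\in D_0$ the algorithm $CSV$ is well defined and terminates, giving a bijection $CSV:D_0\to R_{\le-1}$; moreover $$CSV=\phi\circ GK\circ\phi^{-1}.$$ Furthermore, one loop step of $CSV$ is $\phi\circ\bar\gamma\circ\phi^{-1}$: if $v\in W_{121}$ has $t$ unpaired twos, $0\le j<t$, and $\mu$ is the partition with $\phi^{-1}(\mu)=\bar\gamma^{\,j}(v)$ (which exists), then $r(\mu)\ge0$, $\kappa(\mu)$ is defined, and $\kappa(\mu)=\phi(\bar\gamma(\phi^{-1}(\mu)))$. -/

import Mathlib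

namespace Mahonian

/-! ### Words and Foata's fundamental bijection -/

/-- The Kleene closure `ℙ*`: all finite words in the positive integers. -/
abbrev Word := List ℕ+

/-- Words in the alphabet `{1, 2}`. -/
def IsBinary (w : Word) : Prop := ∀ a ∈ w, a = 1 ∨ a = 2

/-- Cut a word immediately after each letter satisfying `p`.  If the last letter of the word
satisfies `p`, this is the unique factorization into nonempty factors in which the last letter
of each factor satisfies `p` and no other letter does. -/
def factors (p : ℕ+ → Bool) : Word → List Word
  | [] => []
  | b :: w =>
    if p b then [b] :: factors p w
    else match factors p w with
      | [] => [[b]]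
      | f :: fs => (b :: f) :: fs

/-- Cyclically shift every factor so that its last letter comes to the front. -/
def shiftFactors (p : ℕ+ → Bool) (w : Word) : Word :=
  ((factors p w).map fun f => f.rotateRight 1).flatten

/-- One step of Foata's construction: from `w` and the next letter `a`. If the last letter `b`
of `w` satisfies `b ≤ a`, the factors are cut after the letters `≤ a`, otherwise after the
letters `> a`; the factors are shifted and `a` is appended. -/
def foataStep (w : Word) (a : ℕ+) : Word :=
  match w.getLast? with
  | none => [a]
  | some b =>
    shiftFactors (if b ≤ a then fun c => decide (c ≤ a) else fun c => decide (a < c)) w ++ [a]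

/-- Foata's map on words. -/
def foata (v : Word) : Word := v.foldl foataStep []

theorem factors_append_cons (p : ℕ+ → Bool) (u : Word) (b : ℕ+) (w : Word)
    (hu : ∀ c ∈ u, p c = false) (hb : p b = true) :
    factors p (u ++ b :: w) = (u ++ [b]) :: factors p w := by
  induction u with
  | nil => simp [factors, hb]
  | cons c u ih =>
    have hc : p c = false := hu c (by simp)
    have := ih (fun d hd => hu d (by simp [hd]))
    simp [factors, hc, this]

theorem rotateRight_concat (u : Word) (b : ℕ+) : (u ++ [b]).rotateRight 1 = b :: u := by
  rcases u with _ | ⟨c, u⟩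
  · simp [List.rotateRight]
  · have h1 : 1 % (u.length + 2) = 1 := Nat.mod_eq_of_lt (by omega)
    simp [List.rotateRight, h1]

theorem shiftFactors_append_cons (p : ℕ+ → Bool) (u : Word) (b : ℕ+) (w : Word)
    (hu : ∀ c ∈ u, p c = false) (hb : p b = true) :
    shiftFactors p (u ++ b :: w) = b :: u ++ shiftFactors p w := by
  simp [shiftFactors, factors_append_cons p u b w hu hb, rotateRight_concat]

/-- Either no letter satisfies `p`, or the word splits at the first letter that does. -/
theorem split_first (p : ℕ+ → Bool) (w : Word) (hw : w ≠ [])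
    (hl : ∀ b ∈ w.getLast?, p b = true) :
    ∃ u b w', w = u ++ b :: w' ∧ (∀ c ∈ u, p c = false) ∧ p b = true ∧
      ∀ b ∈ w'.getLast?, p b = true := by
  induction w with
  | nil => exact absurd rfl hw
  | cons c w ih =>
    by_cases hc : p c = true
    · refine ⟨[], c, w, rfl, by simp, hc, ?_⟩
      intro b hb
      apply hl
      rcases w with _ | ⟨d, w⟩
      · simp at hb
      · simpa [List.getLast?_cons_cons] using hb
    · have hne : w ≠ [] := by
        rintro rfl
        exact hc (hl c (by simp))
      obtain ⟨u, b, w', rfl, h1, h2, h3⟩ := ih hne (by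
        intro b hb
        apply hl
        rcases w with _ | ⟨d, w⟩
        · exact absurd rfl hne
        · simpa [List.getLast?_cons_cons] using hb)
      refine ⟨c :: u, b, w', rfl, ?_, h2, h3⟩
      intro d hd
      rcases List.mem_cons.1 hd with rfl | hd
      · simpa using hc
      · exact h1 d hd

theorem shiftFactors_append (p : ℕ+ → Bool) : ∀ (n : ℕ) (z y : Word), z.length ≤ n →
    (∀ b ∈ z.getLast?, p b = true) →
    shiftFactors p (z ++ y) = shiftFactors p z ++ shiftFactors p y
  | 0, z, y, hn, _ => by
    have : z = [] := by simpa using hn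
    subst this
    simp [shiftFactors, factors]
  | n + 1, z, y, hn, hl => by
    by_cases hz : z = []
    · subst hz
      simp [shiftFactors, factors]
    · obtain ⟨u, b, w', rfl, h1, h2, h3⟩ := split_first p z hz hl
      have := shiftFactors_append p n w' y (by simp at hn; omega) h3
      rw [List.append_assoc, List.cons_append, shiftFactors_append_cons p u b _ h1 h2, this,
        shiftFactors_append_cons p u b _ h1 h2, List.append_assoc]

theorem head_shiftFactors (p : ℕ+ → Bool) (w : Word) (hl : ∀ b ∈ w.getLast?, p b = true) :
    ∀ b ∈ (shiftFactors p w).head?, p b = true := by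
  by_cases hw : w = []
  · subst hw
    simp [shiftFactors, factors]
  · obtain ⟨u, b, w', rfl, h1, h2, -⟩ := split_first p w hw hl
    simp [shiftFactors_append_cons p u b _ h1 h2, h2]

/-- Shifting is undone by shifting the reversed word. -/
theorem reverse_shiftFactors (p : ℕ+ → Bool) : ∀ (n : ℕ) (w : Word), w.length ≤ n →
    (∀ b ∈ w.getLast?, p b = true) →
    (shiftFactors p (shiftFactors p w).reverse).reverse = w
  | 0, w, hn, _ => by
    have : w = [] := by simpa using hn
    subst this
    simp [shiftFactors, factors]
  | n + 1, w, hn, hl => by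
    by_cases hz : w = []
    · subst hz
      simp [shiftFactors, factors]
    · obtain ⟨u, b, w', rfl, h1, h2, h3⟩ := split_first p w hz hl
      have ih := reverse_shiftFactors p n w' (by simp at hn; omega) h3
      have hr : ∀ c ∈ (shiftFactors p w').reverse.getLast?, p c = true := by
        rw [List.getLast?_reverse]
        exact head_shiftFactors p w' h3
      rw [shiftFactors_append_cons p u b _ h1 h2, List.reverse_append,
        shiftFactors_append p _ _ _ le_rfl hr, List.reverse_cons,
        shiftFactors_append_cons p u.reverse b [] (by simpa using h1) h2, List.reverse_append,
        ih]
      simp [shiftFactors, factors]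

theorem length_shiftFactors (p : ℕ+ → Bool) : ∀ (n : ℕ) (w : Word), w.length ≤ n →
    (∀ b ∈ w.getLast?, p b = true) → (shiftFactors p w).length = w.length
  | 0, w, hn, _ => by
    have : w = [] := by simpa using hn
    subst this
    simp [shiftFactors, factors]
  | n + 1, w, hn, hl => by
    by_cases hz : w = []
    · subst hz
      simp [shiftFactors, factors]
    · obtain ⟨u, b, w', rfl, h1, h2, h3⟩ := split_first p w hz hl
      have ih := length_shiftFactors p n w' (by simp at hn; omega) h3
      rw [shiftFactors_append_cons p u b _ h1 h2]
      simp [ih]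
      omega

theorem foata_concat (v : Word) (a : ℕ+) : foata (v ++ [a]) = foataStep (foata v) a := by
  simp [foata]

/-- The predicate used in a step: with the last letter `b` and the new letter `a`. -/
theorem stepPred_self (a b : ℕ+) :
    (if b ≤ a then fun c => decide (c ≤ a) else fun c => decide (a < c) : ℕ+ → Bool) b
      = true := by
  split_ifs with h
  · simpa using h
  · simpa using h

/-- The predicate used in a step is determined by any letter satisfying it. -/
theorem stepPred_congr (a b c : ℕ+)
    (h : (if b ≤ a then fun c => decide (c ≤ a) else fun c => decide (a < c) : ℕ+ → Bool) c
      = true) :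
    (if b ≤ a then fun c => decide (c ≤ a) else fun c => decide (a < c) : ℕ+ → Bool) =
      if c ≤ a then fun c => decide (c ≤ a) else fun c => decide (a < c) := by
  by_cases hb : b ≤ a
  · rw [if_pos hb] at h
    rw [if_pos hb, if_pos (by simpa using h)]
  · rw [if_neg hb] at h
    rw [if_neg hb, if_neg (by simpa using h)]

theorem foataStep_unstep (w : Word) (a : ℕ+) :
    ∃ w', w'.length = w.length ∧ foataStep w' a = w ++ [a] := by
  rcases w with _ | ⟨b, w⟩
  · exact ⟨[], rfl, rfl⟩
  · set p : ℕ+ → Bool :=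
      if b ≤ a then fun c => decide (c ≤ a) else fun c => decide (a < c) with hp
    have hpb : p b = true := stepPred_self a b
    have hl : ∀ c ∈ (b :: w).reverse.getLast?, p c = true := by
      simpa using hpb
    have hlen := length_shiftFactors p _ (b :: w).reverse le_rfl hl
    refine ⟨(shiftFactors p (b :: w).reverse).reverse, by simpa using hlen, ?_⟩
    have hinv := reverse_shiftFactors p _ (b :: w).reverse le_rfl hl
    have hhead := head_shiftFactors p (b :: w).reverse hl
    rcases hs : shiftFactors p (b :: w).reverse with _ | ⟨c, s⟩
    · rw [hs] at hlen
      simp at hlen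
    · rw [hs] at hinv hhead
      have hpc : p c = true := hhead c (by simp)
      have hpe := stepPred_congr a b c hpc
      rw [← hp] at hpe
      have h2 := congrArg List.reverse hinv
      rw [List.reverse_reverse, List.reverse_reverse] at h2
      simp only [foataStep, List.getLast?_reverse, List.head?_cons]
      rw [← hpe, h2]

theorem foataStep_injective (w w' : Word) (a a' : ℕ+)
    (h : foataStep w a = foataStep w' a') : w = w' ∧ a = a' := by
  have key : ∀ (w : Word) (a : ℕ+), ∃ s : Word, foataStep w a = s ++ [a] ∧
      ((s = [] ∧ w = []) ∨ ∃ c s', s = c :: s' ∧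
        w = (shiftFactors (if c ≤ a then fun c => decide (c ≤ a) else fun c => decide (a < c))
          s.reverse).reverse) := by
    intro w a
    by_cases hw : w = []
    · subst hw
      exact ⟨[], rfl, Or.inl ⟨rfl, rfl⟩⟩
    · obtain ⟨b, hb⟩ : ∃ b, w.getLast? = some b := ⟨_, List.getLast?_eq_some_getLast hw⟩
      set p : ℕ+ → Bool :=
        if b ≤ a then fun c => decide (c ≤ a) else fun c => decide (a < c) with hp
      have hl : ∀ c ∈ w.getLast?, p c = true := by
        rw [hb]
        intro c hc
        obtain rfl : b = c := by simpa using hc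
        exact stepPred_self a b
      refine ⟨shiftFactors p w, by simp [foataStep, hb, hp], Or.inr ?_⟩
      have hlen := length_shiftFactors p _ w le_rfl hl
      have hhead := head_shiftFactors p w hl
      have hinv := reverse_shiftFactors p _ w le_rfl hl
      rcases hs : shiftFactors p w with _ | ⟨c, s⟩
      · rw [hs] at hlen
        exact absurd (List.length_eq_zero_iff.1 hlen.symm) hw
      · rw [hs] at hinv hhead
        have hpe := stepPred_congr a b c (hhead c (by simp))
        rw [← hp] at hpe
        exact ⟨c, s, rfl, by rw [← hpe, hinv]⟩
  obtain ⟨s, hs, hs'⟩ := key w a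
  obtain ⟨t, ht, ht'⟩ := key w' a'
  rw [hs, ht] at h
  obtain ⟨rfl, h2⟩ := List.append_inj' h rfl
  obtain rfl : a = a' := by simpa using h2
  refine ⟨?_, rfl⟩
  rcases hs' with ⟨h1, rfl⟩ | ⟨c, s', hc, rfl⟩
  · rcases ht' with ⟨-, rfl⟩ | ⟨c, s', hc, -⟩
    · rfl
    · rw [h1] at hc
      simp at hc
  · rcases ht' with ⟨h1, -⟩ | ⟨d, s'', hd, rfl⟩
    · rw [h1] at hc
      simp at hc
    · rw [hc] at hd
      obtain ⟨rfl, -⟩ := List.cons.inj hd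
      rfl

theorem foataStep_ne_nil (w : Word) (a : ℕ+) : foataStep w a ≠ [] := by
  unfold foataStep
  split <;> simp

theorem foata_injective : Function.Injective foata := by
  intro v
  induction v using List.reverseRecOn with
  | nil =>
    intro v' h
    rcases List.eq_nil_or_concat' v' with rfl | ⟨u, a, rfl⟩
    · rfl
    · rw [foata_concat] at h
      exact absurd h.symm (foataStep_ne_nil _ _)
  | append_singleton v a ih =>
    intro v' h
    rcases List.eq_nil_or_concat' v' with rfl | ⟨u, a', rfl⟩
    · rw [foata_concat] at h
      exact absurd h (foataStep_ne_nil _ _)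
    · rw [foata_concat, foata_concat] at h
      obtain ⟨h1, rfl⟩ := foataStep_injective _ _ _ _ h
      rw [ih h1]

theorem foata_surjective : Function.Surjective foata := by
  have : ∀ (n : ℕ) (w : Word), w.length = n → ∃ v, foata v = w := by
    intro n
    induction n with
    | zero =>
      intro w hw
      exact ⟨[], (List.length_eq_zero_iff.1 hw).symm⟩
    | succ n ih =>
      intro w hw
      rcases List.eq_nil_or_concat' w with rfl | ⟨u, a, rfl⟩
      · simp at hw
      · obtain ⟨u', hu', hstep⟩ := foataStep_unstep u a
        obtain ⟨v, rfl⟩ := ih u' (by simp at hw; omega)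
        exact ⟨v ++ [a], by rw [foata_concat, hstep]⟩
  exact fun w => this _ w rfl

/-- Foata's fundamental bijection `φ : ℙ* → ℙ*`. -/
noncomputable def phi : Word ≃ Word :=
  Equiv.ofBijective foata ⟨foata_injective, foata_surjective⟩

/-! ### Ballot sequences and the sets `W_v`, `B_v` -/

/-- In every prefix and for every `i`, there are at least as many `i`'s as `(i+1)`'s. -/
def IsBallot (w : Word) : Prop :=
  ∀ u : Word, u <+: w → ∀ i : ℕ+, u.count (i + 1) ≤ u.count i

/-- `W_v`: the binary words ending in `v`, together with the empty word. -/
def W (v : Word) : Set Word := {w | w = [] ∨ ∃ x : Word, IsBinary x ∧ w = x ++ v}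

/-- `B_v`: the ballot sequences in `W_v`. -/
def B (v : Word) : Set Word := {w | w ∈ W v ∧ IsBallot w}

/-! ### Pairing of ones and twos, and the Greene–Kleitman map -/

/-- Put a letter (with its position) in front of a word in which no one is immediately followed
by a two, and remove the pair `12` that may arise at the front. -/
def consCancel (a : ℕ+ × ℕ) : List (ℕ+ × ℕ) → List (ℕ+ × ℕ)
  | [] => [a]
  | b :: s => if a.1 = 1 ∧ b.1 = 2 then s else a :: b :: s

/-- The unpaired letters of a binary word, each with its position (counted from `0`), from left
to right: what is left after ones immediately followed by twos have been removed, in pairs,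
until there are no more. -/
def unpaired (w : Word) : List (ℕ+ × ℕ) := w.zipIdx.foldr consCancel []

/-- The positions of the unpaired twos, from left to right. -/
def unpairedTwos (w : Word) : List ℕ :=
  ((unpaired w).filter fun a => a.1 = 2).map Prod.snd

/-- `γ`: change the rightmost unpaired two to a one (words without unpaired twos are
left alone). -/
def gamma (w : Word) : Word :=
  match (unpairedTwos w).getLast? with
  | none => w
  | some k => w.set k 1

/-- `GK(x121) = γ^t(x) 1 2^(t+1) 1`, where `t` is the number of unpaired twos of `x121`, and
`GK` of the empty word is the empty word. -/
def GK (v : Word) : Word :=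
  if v = [] then []
  else
    let t := (unpairedTwos v).length
    gamma^[t] (v.rdrop 3) ++ [1] ++ List.replicate (t + 1) 2 ++ [1]

/-- `γ̄(x 1 2^m 1) = γ(x) 1 2^(m+1) 1`. -/
def gammaBar (u : Word) : Word :=
  let s := u.dropLast
  let m := (s.rtakeWhile fun a => a = 2).length
  let x := (s.rdropWhile fun a => a = 2).dropLast
  gamma x ++ [1] ++ List.replicate (m + 1) 2 ++ [1]

/-! ### Partitions

Partitions are Young diagrams in English notation; the part `λ_i` is `lam.rowLen (i - 1)`, the
part `λ'_i` of the conjugate is `lam.colLen (i - 1)`. -/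

/-- The word `w(λ)`: the steps along the southeast boundary of the diagram, from its southwest
to its northeast end, a north step being a `1` and an east step a `2`.  From bottom to top, row
`i` contributes `λ_i - λ_{i+1}` east steps and then one north step. -/
def boundaryWord (lam : YoungDiagram) : Word :=
  (List.range (lam.colLen 0)).reverse.flatMap fun i =>
    List.replicate (lam.rowLen i - lam.rowLen (i + 1)) 2 ++ [1]

/-- `d(λ)`: the side of the Durfee square, the largest `d × d` square in the diagram. -/
def durfee (lam : YoungDiagram) : ℕ :=
  Nat.findGreatest (fun d => ∀ i < d, ∀ j < d, (i, j) ∈ lam) lam.card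

/-- The `i`-th rank `r_i(λ) = λ_i - λ'_i`, for `1 ≤ i ≤ d(λ)`. -/
def rank (lam : YoungDiagram) (i : ℕ) : ℤ :=
  (lam.rowLen (i - 1) : ℤ) - (lam.colLen (i - 1) : ℤ)

/-- `r(λ)`: the maximum of the ranks; it is `⊥` (that is, `-∞`) for the empty partition. -/
def maxRank (lam : YoungDiagram) : WithBot ℤ :=
  (Finset.Icc 1 (durfee lam)).sup fun i => (rank lam i : WithBot ℤ)

/-- `D_t`: the partitions with `λ_1 - λ_2 = t`. -/
def D (t : ℕ) : Set YoungDiagram := {lam | lam.rowLen 0 = lam.rowLen 1 + t}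

/-- `R_{≤ t}`: the partitions all of whose ranks are at most `t`. -/
def RLe (t : ℤ) : Set YoungDiagram :=
  {lam | ∀ i, 1 ≤ i → i ≤ durfee lam → rank lam i ≤ t}

/-- The multiset of the parts of a partition. -/
def parts (lam : YoungDiagram) : Multiset ℕ := (lam.rowLens : Multiset ℕ)

/-- The partition with the given parts (zeros are ignored). -/
def ofParts (m : Multiset ℕ) : YoungDiagram :=
  YoungDiagram.ofRowLens (m.sort (· ≥ ·)) (Multiset.pairwise_sort m (· ≥ ·)).sortedGE

/-! ### The algorithm `CSV` -/

/-- `i(λ)`: the maximum index `i` with `r_i(λ) = r(λ)`. -/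
def maxRankIndex (lam : YoungDiagram) : ℕ :=
  Nat.findGreatest (fun i => 1 ≤ i ∧ (rank lam i : WithBot ℤ) = maxRank lam) (durfee lam)

/-- Remove a part of size `i` from the conjugate. -/
def removeConjPart (i : ℕ) (lam : YoungDiagram) : YoungDiagram :=
  (ofParts ((parts lam.transpose).erase i)).transpose

/-- Add a part of size `k`. -/
def addPart (k : ℕ) (lam : YoungDiagram) : YoungDiagram := ofParts (k ::ₘ parts lam)

/-- Increase the largest part by one. -/
def growFirst (lam : YoungDiagram) : YoungDiagram :=
  ofParts ((lam.rowLen 0 + 1) ::ₘ (parts lam).erase (lam.rowLen 0))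

/-- The loop body `κ`, undefined if the conjugate has no part of size `i = i(λ)`: remove a part
of size `i` from `λ'`, add a part of size `i - 1` to `λ`, and increase `λ_1` by one. -/
def kappa (lam : YoungDiagram) : Option YoungDiagram :=
  let i := maxRankIndex lam
  if i ∈ parts lam.transpose then
    some (growFirst (addPart (i - 1) (removeConjPart i lam)))
  else none

/-- One test of the loop condition: while `r(λ) ≥ 0` continue with `κ(λ)`, otherwise
output `λ`. -/
noncomputable def csvStep (lam : YoungDiagram) : Part (YoungDiagram ⊕ YoungDiagram) :=
  if 0 ≤ maxRank lam then (Part.ofOption (kappa lam)).map Sum.inr else Part.some (Sum.inl lam)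

/-- The algorithm `CSV` as a partial map: the while loop iterates `csvStep` until it outputs;
the result is undefined if some `κ` is, or if the loop does not terminate. -/
noncomputable def CSV : YoungDiagram →. YoungDiagram := PFun.fix csvStep

end Mahonian

open Mahonian

namespace Mahonian

/-! ### Heights and unpaired twos -/

/-! Read a binary word as a path with up-steps `2` and down-steps `1`. The number of unpaired twos
is the largest prefix height (`excess`), and the rightmost unpaired two is the step that first
reaches this height. Thus ballot means excess zero. Changing that two to a one makes it the leftmost
unpaired one, so `gamma` can be undone; this gives `bijOn_GK`.

On binary words Foata's map obeys three rules: `φ(v2) = φ(v)2`, `φ(v11) = 1φ(v1)`, `φ(v21) =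
2φ(v)1`. Each factor `21` therefore wraps the image of what precedes it. If `v = y21s` and `s` has
`d` descents, then `φ(v) = l 2 φ(y) 1 r` with `d` twos in `l` and `d` ones in `r`
(`exists_phi_append`). In the diagram under the path `φ(v)` this two is column `d + 1` and this one
is row `d + 1`, so the rank of index `d + 1` is the height of `y` (`rank_diagram_phi`), and the
Durfee side is the number of descents (`durfee_diagram_phi`). Hence all ranks are negative exactly
when `v` is ballot, for `v` empty or ending in a one. The largest index of maximal rank belongs to
the rightmost unpaired two (`maxRank_diagram_phi`).

Changing that two to a one and lengthening the final run of twos alters `φ(v)` in three places: a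
two is deleted, a one is inserted, and a two is inserted before the last letter. These are the three
operations of `kappa` (`kappa_diagram_phi`). The loop runs once for each unpaired two and stops at
excess zero, so `CSV` is conjugate to `GK`. -/

@[simp] theorem isBinary_nil : IsBinary [] := by simp [IsBinary]

@[simp] theorem isBinary_cons {a : ℕ+} {w : Word} :
    IsBinary (a :: w) ↔ (a = 1 ∨ a = 2) ∧ IsBinary w := by simp [IsBinary]

@[simp] theorem isBinary_append {u w : Word} :
    IsBinary (u ++ w) ↔ IsBinary u ∧ IsBinary w := by
  simp [IsBinary, or_imp, forall_and]

@[simp] theorem isBinary_replicate_two (n : ℕ) : IsBinary (List.replicate n 2) := by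
  intro a ha
  exact Or.inr (List.eq_of_mem_replicate ha)

/-- The number of twos minus the number of ones of a binary word. -/
def height : Word → ℤ
  | [] => 0
  | a :: w => (if a = 2 then 1 else -1) + height w

/-- The largest height of a prefix. -/
def excess : Word → ℤ
  | [] => 0
  | a :: w => max 0 ((if a = 2 then 1 else -1) + excess w)

theorem excess_nonneg (w : Word) : 0 ≤ excess w := by
  cases w <;> simp [excess]

@[simp] theorem height_nil : height [] = 0 := rfl

@[simp] theorem excess_nil : excess [] = 0 := rfl

@[simp] theorem height_one_cons (w : Word) : height (1 :: w) = height w - 1 := by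
  have : (1 : ℕ+) ≠ 2 := by decide
  simp [height, this]
  ring

@[simp] theorem height_two_cons (w : Word) : height (2 :: w) = height w + 1 := by
  simp [height]
  ring

@[simp] theorem excess_one_cons (w : Word) : excess (1 :: w) = max 0 (excess w - 1) := by
  have : (1 : ℕ+) ≠ 2 := by decide
  simp only [excess, this, if_false]
  congr 1
  ring

@[simp] theorem excess_two_cons (w : Word) : excess (2 :: w) = excess w + 1 := by
  have := excess_nonneg w
  simp only [excess, if_true]
  rw [max_eq_right (by omega)]
  ring

@[simp] theorem height_append (u w : Word) : height (u ++ w) = height u + height w := by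
  induction u with
  | nil => simp
  | cons a u ih => simp [height, ih]; ring

@[simp] theorem excess_append (u w : Word) :
    excess (u ++ w) = max (excess u) (height u + excess w) := by
  induction u with
  | nil => simp [excess_nonneg]
  | cons a u ih =>
    simp only [List.cons_append, excess, ih, height]
    omega

@[simp] theorem height_replicate_two (n : ℕ) : height (List.replicate n 2) = n := by
  induction n with
  | zero => simp
  | succ n ih => simp [List.replicate_succ, ih]

@[simp] theorem excess_replicate_two (n : ℕ) : excess (List.replicate n 2) = n := by
  induction n with
  | zero => simp
  | succ n ih => simp [List.replicate_succ, ih]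

theorem height_le_excess (w : Word) : height w ≤ excess w := by
  have := excess_append w []
  simp at this
  exact this

theorem height_eq_count {w : Word} (hw : IsBinary w) :
    height w = (w.count 2 : ℤ) - w.count 1 := by
  induction w with
  | nil => simp
  | cons a w ih =>
    obtain ⟨rfl | rfl, hw'⟩ := isBinary_cons.1 hw
    · simp [ih hw', show (1 : ℕ+) ≠ 2 by decide]
      ring
    · simp [ih hw', show (2 : ℕ+) ≠ 1 by decide]
      ring

/-- The rightmost unpaired two of a binary word follows a word without unpaired ones and precedes
a word without unpaired twos. -/
def IsLastUnpairedTwo (y z : Word) : Prop := excess y = height y ∧ excess z = 0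

/-- A final one in `y` would leave the height below a value already reached. The resulting shape of
`y` decides which of Foata's rules applies when the two after `y` becomes a one. -/
theorem IsLastUnpairedTwo.eq_nil_or_two {y z : Word} (h : IsLastUnpairedTwo y z)
    (hy : IsBinary y) : y = [] ∨ ∃ y', y = y' ++ [2] := by
  rcases List.eq_nil_or_concat' y with rfl | ⟨y', a, rfl⟩
  · exact Or.inl rfl
  · obtain ⟨-, rfl | rfl⟩ : IsBinary y' ∧ (a = 1 ∨ a = 2) := by simpa using hy
    · have h1 := h.1
      have := height_le_excess y'
      simp at h1
      omega
    · exact Or.inr ⟨y', rfl⟩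

theorem IsLastUnpairedTwo.excess_two {y z : Word} (h : IsLastUnpairedTwo y z) :
    excess (y ++ 2 :: z) = height y + 1 := by
  obtain ⟨h1, h2⟩ := h
  simp [h1, h2]

theorem IsLastUnpairedTwo.excess_one {y z : Word} (h : IsLastUnpairedTwo y z) :
    excess (y ++ 1 :: z) = height y := by
  obtain ⟨h1, h2⟩ := h
  simp [h1, h2]

/-- A factorization of this kind is unique, even when the letter in the middle is unknown. -/
theorem IsLastUnpairedTwo.unique {a : ℕ+} {y z y' z' : Word} (ha : a = 1 ∨ a = 2)
    (h : IsLastUnpairedTwo y z) (h' : IsLastUnpairedTwo y' z')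
    (he : y ++ a :: z = y' ++ a :: z') : y = y' ∧ z = z' := by
  -- If the two factorizations differ, the word `p` between the two middle letters lies in both `z`
  -- and `y'`. The first bounds its height from above, the second from below, and the middle letters
  -- make the bounds incompatible.
  have key : ∀ {y z y' z' : Word}, IsLastUnpairedTwo y z → IsLastUnpairedTwo y' z' →
      ∀ p, y' = y ++ a :: p → z = p ++ a :: z' → False := by
    rintro y z y' z' ⟨h1, h2⟩ ⟨h3, h4⟩ p rfl rfl
    rcases ha with rfl | rfl
    · have := height_le_excess p
      have := height_le_excess y
      simp at h2 h3
      omega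
    · have := height_le_excess p
      simp at h2 h3
      have := excess_nonneg z'
      have := excess_nonneg p
      omega
  rcases List.append_eq_append_iff.1 he with ⟨p, h1, h2⟩ | ⟨p, h1, h2⟩
  · cases p with
    | nil => simp at h1 h2; exact ⟨h1.symm, h2⟩
    | cons b p =>
      obtain ⟨rfl, h3⟩ := List.cons.inj h2
      exact (key h h' p h1 h3).elim
  · cases p with
    | nil => simp at h1 h2; exact ⟨h1, h2.symm⟩
    | cons b p =>
      obtain ⟨rfl, h3⟩ := List.cons.inj h2
      exact (key h' h p h1 h3).elim

/-- The reduction leaves twos followed by ones. The starting position `k` is arbitrary because the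
induction passes to the tail, whose positions are shifted. -/
theorem unpaired_structure {w : Word} (hw : IsBinary w) (k : ℕ) :
    ∃ p q : List ℕ, (w.zipIdx k).foldr consCancel [] =
        p.map (fun i => ((2 : ℕ+), i)) ++ q.map (fun i => ((1 : ℕ+), i)) ∧
      (p.length : ℤ) = excess w ∧
      (p = [] ∨ ∃ y z, w = y ++ 2 :: z ∧ IsLastUnpairedTwo y z ∧
        p.getLast? = some (k + y.length)) := by
  induction w generalizing k with
  | nil => exact ⟨[], [], by simp, by simp, Or.inl rfl⟩
  | cons a w ih =>
    obtain ⟨ha, hw⟩ := isBinary_cons.1 hw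
    obtain ⟨p, q, h1, h2, h3⟩ := ih hw (k + 1)
    simp only [List.zipIdx_cons, List.foldr_cons, h1]
    have hne : (1 : ℕ+) ≠ 2 := by decide
    rcases ha with rfl | rfl
    · rcases p with _ | ⟨c, p⟩
      · refine ⟨[], k :: q, ?_, ?_, Or.inl rfl⟩
        · cases q <;> simp [consCancel, hne]
        · simp at h2
          simp [← h2]
      -- A new one in front cancels the leftmost unpaired two, so the rightmost one survives unless
      -- it was the only one.
      · refine ⟨p, q, by simp [consCancel], ?_, ?_⟩
        · simp at h2
          simp [← h2]
        · rcases p with _ | ⟨d, p⟩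
          · exact Or.inl rfl
          · obtain h3 | ⟨y, z, rfl, hyz, h3⟩ := h3
            · simp at h3
            · refine Or.inr ⟨1 :: y, z, rfl, ⟨?_, hyz.2⟩, ?_⟩
              · rw [hyz.excess_two] at h2
                simp at h2
                simp [hyz.1]
                omega
              · rw [List.getLast?_cons_cons] at h3
                rw [h3]
                simp
                omega
    · refine ⟨k :: p, q, ?_, by simp [h2], Or.inr ?_⟩
      · cases p <;> cases q <;> simp [consCancel, hne, hne.symm]
      · rcases p with _ | ⟨d, p⟩
        · refine ⟨[], w, rfl, ⟨by simp, by simpa using h2.symm⟩, by simp⟩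
        · obtain h3 | ⟨y, z, rfl, hyz, h3⟩ := h3
          · simp at h3
          · refine ⟨2 :: y, z, rfl, ⟨by simp [hyz.1], hyz.2⟩, ?_⟩
            rw [List.getLast?_cons_cons, h3]
            simp
            omega

theorem unpairedTwos_eq {w : Word} (hw : IsBinary w) :
    ((unpairedTwos w).length : ℤ) = excess w ∧
      (unpairedTwos w = [] ∨ ∃ y z, w = y ++ 2 :: z ∧ IsLastUnpairedTwo y z ∧
        (unpairedTwos w).getLast? = some y.length) := by
  obtain ⟨p, q, h1, h2, h3⟩ := unpaired_structure hw 0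
  have : unpairedTwos w = p := by
    have hne : (1 : ℕ+) ≠ 2 := by decide
    rw [unpairedTwos, unpaired, h1, List.filter_append, List.map_append, List.filter_map,
      List.filter_map]
    simp [Function.comp_def, hne]
  rw [this]
  simpa using And.intro h2 h3

theorem exists_isLastUnpairedTwo {w : Word} (hw : IsBinary w) (h : 0 < excess w) :
    ∃ y z, w = y ++ 2 :: z ∧ IsLastUnpairedTwo y z := by
  obtain ⟨h1, h2 | ⟨y, z, h2, h3, -⟩⟩ := unpairedTwos_eq hw
  · simp [h2] at h1
    omega
  · exact ⟨y, z, h2, h3⟩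

theorem gamma_eq {y z : Word} (hy : IsBinary y) (hz : IsBinary z) (h : IsLastUnpairedTwo y z) :
    gamma (y ++ 2 :: z) = y ++ 1 :: z := by
  have hw : IsBinary (y ++ 2 :: z) := by simp [hy, hz]
  obtain ⟨h1, h2 | ⟨y', z', h2, h3, h4⟩⟩ := unpairedTwos_eq hw
  · have := height_le_excess y
    have := excess_nonneg y
    have := h.1
    rw [h.excess_two] at h1
    simp [h2] at h1
    omega
  · obtain ⟨rfl, rfl⟩ := h.unique (Or.inr rfl) h3 h2
    simp [gamma, h4]

theorem gamma_spec {w : Word} (hw : IsBinary w) (h : 0 < excess w) :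
    ∃ y z, w = y ++ 2 :: z ∧ gamma w = y ++ 1 :: z ∧ IsBinary y ∧ IsBinary z ∧
      IsLastUnpairedTwo y z := by
  obtain ⟨y, z, rfl, hyz⟩ := exists_isLastUnpairedTwo hw h
  obtain ⟨hy, hz⟩ : IsBinary y ∧ IsBinary z := by simpa using hw
  exact ⟨y, z, rfl, gamma_eq hy hz hyz, hy, hz, hyz⟩

theorem gamma_iterate {x : Word} (hx : IsBinary x) (j : ℕ) (hj : j ≤ excess x) :
    IsBinary (gamma^[j] x) ∧ excess (gamma^[j] x) = excess x - j ∧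
      height (gamma^[j] x) = height x - 2 * j := by
  induction j with
  | zero => simpa using hx
  | succ j ih =>
    obtain ⟨h1, h2, h3⟩ := ih (by push_cast at hj; omega)
    rw [Function.iterate_succ_apply']
    obtain ⟨y, z, h4, h5, hy, hz, hyz⟩ := gamma_spec h1 (by push_cast at hj; omega)
    rw [h5, hyz.excess_one]
    rw [h4] at h2 h3
    rw [hyz.excess_two] at h2
    refine ⟨by simp [hy, hz], by push_cast; omega, ?_⟩
    simp at h3 ⊢
    omega

/-- The letter changed by `gamma` becomes the leftmost unpaired one, so `IsLastUnpairedTwo.unique`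
with middle letter one recovers it. -/
theorem gamma_iterate_injective {x x' : Word} (hx : IsBinary x) (hx' : IsBinary x') (t : ℕ)
    (h : excess x = t) (h' : excess x' = t) (he : gamma^[t] x = gamma^[t] x') : x = x' := by
  induction t generalizing x x' with
  | zero => exact he
  | succ t ih =>
    obtain ⟨y, z, rfl, h1, hy, hz, hyz⟩ := gamma_spec hx (by omega)
    obtain ⟨y', z', rfl, h1', hy', hz', hyz'⟩ := gamma_spec hx' (by omega)
    rw [hyz.excess_two] at h
    rw [hyz'.excess_two] at h'
    rw [Function.iterate_succ_apply, Function.iterate_succ_apply, h1, h1'] at he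
    have := ih (by simp [hy, hz]) (by simp [hy', hz'])
      (by rw [hyz.excess_one]; push_cast at h; omega)
      (by rw [hyz'.excess_one]; push_cast at h'; omega) he
    obtain ⟨rfl, rfl⟩ := hyz.unique (Or.inl rfl) hyz' this
    rfl

/-- A word with an unpaired one factors at its leftmost unpaired one. -/
theorem exists_first_unpaired_one {w : Word} (hw : IsBinary w) (h : height w < excess w) :
    ∃ y z, w = y ++ 1 :: z ∧ IsLastUnpairedTwo y z := by
  induction w with
  | nil => simp at h
  | cons a w ih =>
    obtain ⟨rfl | rfl, hw'⟩ := isBinary_cons.1 hw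
    · by_cases h0 : excess w = 0
      · exact ⟨[], w, rfl, by simp, h0⟩
      · have := excess_nonneg w
        simp at h
        obtain ⟨y, z, rfl, hyz⟩ := ih hw' (by omega)
        rw [hyz.excess_one] at h0
        refine ⟨1 :: y, z, rfl, ?_, hyz.2⟩
        have := excess_nonneg y
        have := hyz.1
        simp
        omega
    · simp at h
      obtain ⟨y, z, rfl, hyz⟩ := ih hw' h
      exact ⟨2 :: y, z, rfl, by simp [hyz.1], hyz.2⟩

/-- Turn leftmost unpaired ones into twos, one at a time. A word of excess zero and height at most
`-t` has at least `t` unpaired ones, so they do not run out. -/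
theorem exists_gamma_iterate_eq {y : Word} (hy : IsBinary y) (h0 : excess y = 0) (t : ℕ)
    (ht : height y ≤ -t) : ∃ x, IsBinary x ∧ excess x = t ∧ height x = height y + 2 * t ∧
      gamma^[t] x = y := by
  induction t with
  | zero => exact ⟨y, hy, by simpa using h0, by simp, rfl⟩
  | succ t ih =>
    push_cast at ht
    obtain ⟨x, hx, h1, h2, h3⟩ := ih (by omega)
    obtain ⟨u, z, rfl, huz⟩ := exists_first_unpaired_one hx (by omega)
    obtain ⟨hu, hz⟩ : IsBinary u ∧ IsBinary z := by simpa using hx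
    rw [huz.excess_one] at h1
    refine ⟨u ++ 2 :: z, by simp [hu, hz], ?_, ?_, ?_⟩
    · rw [huz.excess_two]
      push_cast
      omega
    · simp at h2 ⊢
      omega
    · rw [Function.iterate_succ_apply, gamma_eq hu hz huz, h3]

theorem isBallot_iff {w : Word} (hw : IsBinary w) : IsBallot w ↔ excess w = 0 := by
  constructor
  · intro h
    by_contra h0
    have := excess_nonneg w
    obtain ⟨y, z, rfl, hyz⟩ := exists_isLastUnpairedTwo hw (by omega)
    have hy : IsBinary y := (isBinary_append.1 hw).1
    have h1 := h (y ++ [2]) ⟨z, by simp⟩ 1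
    have h2 := height_eq_count hy
    have := excess_nonneg y
    have := hyz.1
    simp [List.count_append, show (1 : ℕ+) + 1 = 2 by decide] at h1
    omega
  · rintro h u ⟨z, rfl⟩ i
    have hu : IsBinary u := (isBinary_append.1 hw).1
    by_cases hi : i = 1
    · subst hi
      have h2 := height_eq_count hu
      have := height_le_excess u
      simp at h
      rw [show (1 : ℕ+) + 1 = 2 by decide]
      omega
    · rw [List.count_eq_zero_of_not_mem]
      · exact Nat.zero_le _
      · intro hm
        rcases hu _ hm with h3 | h3
        · exact absurd h3 (PNat.lt_add_left 1 i).ne'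
        · exact hi (add_right_cancel (h3.trans (by decide : (2 : ℕ+) = 1 + 1)))

/-! ### The Greene–Kleitman map -/

theorem rtakeWhile_replicate_two (y : Word) (m : ℕ) :
    (y ++ [1] ++ List.replicate m 2).rtakeWhile (fun a => decide (a = 2)) =
      List.replicate m 2 := by
  induction m with
  | zero => simp [show (1 : ℕ+) ≠ 2 by decide]
  | succ m ih =>
    rw [List.replicate_succ', ← List.append_assoc, List.rtakeWhile_concat_pos, ih]
    simp

theorem rdropWhile_replicate_two (y : Word) (m : ℕ) :
    (y ++ [1] ++ List.replicate m 2).rdropWhile (fun a => decide (a = 2)) = y ++ [1] := by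
  induction m with
  | zero => simp [show (1 : ℕ+) ≠ 2 by decide]
  | succ m ih =>
    rw [List.replicate_succ', ← List.append_assoc, List.rdropWhile_concat_pos, ih]
    simp

theorem append_one_replicate_two_inj {y y' : Word} {m m' : ℕ}
    (h : y ++ [1] ++ List.replicate m 2 = y' ++ [1] ++ List.replicate m' 2) :
    y = y' ∧ m = m' := by
  have h1 := rdropWhile_replicate_two y m
  have h2 := rtakeWhile_replicate_two y m
  rw [h, rdropWhile_replicate_two] at h1
  rw [h, rtakeWhile_replicate_two] at h2
  exact ⟨(List.append_cancel_right h1).symm, by simpa using (congrArg List.length h2).symm⟩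

theorem gammaBar_eq (x : Word) (m : ℕ) :
    gammaBar (x ++ [1] ++ List.replicate m 2 ++ [1]) =
      gamma x ++ [1] ++ List.replicate (m + 1) 2 ++ [1] := by
  have h1 := rtakeWhile_replicate_two x m
  have h2 := rdropWhile_replicate_two x m
  simp only [gammaBar, List.dropLast_concat, h1, h2, List.length_replicate]

theorem gammaBar_iterate (x : Word) (j : ℕ) :
    gammaBar^[j] (x ++ [1, 2, 1]) =
      gamma^[j] x ++ [1] ++ List.replicate (j + 1) 2 ++ [1] := by
  induction j with
  | zero => simp
  | succ j ih => rw [Function.iterate_succ_apply', ih, gammaBar_eq, Function.iterate_succ_apply']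

theorem length_unpairedTwos_append {x : Word} (hx : IsBinary x) :
    ((unpairedTwos (x ++ [1, 2, 1])).length : ℤ) = excess x := by
  rw [(unpairedTwos_eq (by simp [hx])).1]
  simp [height_le_excess]

theorem GK_eq {x : Word} (hx : IsBinary x) {t : ℕ} (ht : excess x = t) :
    GK (x ++ [1, 2, 1]) = gamma^[t] x ++ [1] ++ List.replicate (t + 1) 2 ++ [1] := by
  have h1 : (unpairedTwos (x ++ [1, 2, 1])).length = t := by
    have := length_unpairedTwos_append hx
    omega
  have h2 : (x ++ [1, 2, 1]).rdrop 3 = x := List.rdrop_append_length (l₂ := [1, 2, 1])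
  simp [GK, h1, h2]

theorem exists_eq_append_replicate_two {w : Word} (hw : IsBinary w) :
    ∃ m, w = List.replicate m 2 ∨ ∃ y, w = y ++ [1] ++ List.replicate m 2 := by
  induction w using List.reverseRecOn with
  | nil => exact ⟨0, Or.inl rfl⟩
  | append_singleton w a ih =>
    obtain ⟨hw', ha⟩ := isBinary_append.1 hw
    obtain ⟨rfl | rfl, -⟩ := isBinary_cons.1 ha
    · exact ⟨0, Or.inr ⟨w, by simp⟩⟩
    · obtain ⟨m, rfl | ⟨y, rfl⟩⟩ := ih hw'
      · exact ⟨m + 1, Or.inl (by rw [List.replicate_succ'])⟩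
      · exact ⟨m + 1, Or.inr ⟨y, by rw [List.replicate_succ', List.append_assoc]⟩⟩

/-- The final run of twos in the image records `t`. The image is ballot because `γ^t(x)` has excess
zero and height at most `-t`, just enough to absorb `1 2^(t+1)`. Conversely, in a ballot word `y 1
2^m 21` the height of `y` is at most `-m`, which is what undoing `m` applications of `gamma`
requires. -/
theorem bijOn_GK : Set.BijOn GK (W [1, 2, 1]) (B [2, 1]) := by
  refine ⟨?_, ?_, ?_⟩
  · rintro v (rfl | ⟨x, hx, rfl⟩)
    · refine ⟨Or.inl rfl, ?_⟩
      rw [isBallot_iff] <;> simp [GK]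
    · obtain ⟨t, ht⟩ := Int.eq_ofNat_of_zero_le (excess_nonneg x)
      obtain ⟨h1, h2, h3⟩ := gamma_iterate hx t ht.ge
      have := height_le_excess x
      rw [GK_eq hx ht]
      refine ⟨Or.inr ⟨gamma^[t] x ++ [1] ++ List.replicate t 2, by simp [h1], ?_⟩, ?_⟩
      · simp [List.replicate_succ']
      · rw [isBallot_iff (by simp [h1])]
        simp
        omega
  · rintro v (rfl | ⟨x, hx, rfl⟩) v' (rfl | ⟨x', hx', rfl⟩) h
    · rfl
    · obtain ⟨t, ht⟩ := Int.eq_ofNat_of_zero_le (excess_nonneg x')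
      rw [GK_eq hx' ht] at h
      simp [GK] at h
    · obtain ⟨t, ht⟩ := Int.eq_ofNat_of_zero_le (excess_nonneg x)
      rw [GK_eq hx ht] at h
      simp [GK] at h
    · obtain ⟨t, ht⟩ := Int.eq_ofNat_of_zero_le (excess_nonneg x)
      obtain ⟨t', ht'⟩ := Int.eq_ofNat_of_zero_le (excess_nonneg x')
      rw [GK_eq hx ht, GK_eq hx' ht'] at h
      obtain ⟨h1, h2⟩ := append_one_replicate_two_inj (List.append_cancel_right h)
      obtain rfl : t = t' := by omega
      rw [gamma_iterate_injective hx hx' t ht ht' h1]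
  · rintro w ⟨rfl | ⟨x, hx, rfl⟩, hb⟩
    · exact ⟨[], Or.inl rfl, by simp [GK]⟩
    · rw [isBallot_iff (by simp [hx])] at hb
      obtain ⟨m, rfl | ⟨y, rfl⟩⟩ := exists_eq_append_replicate_two hx
      -- A word without ones before the final `21` starts with a two and is not ballot.
      · simp at hb
        omega
      · obtain ⟨⟨hy, -⟩, -⟩ : (_ ∧ _) ∧ _ := by simpa only [isBinary_append] using hx
        simp at hb
        have h0 := excess_nonneg y
        obtain ⟨x, h1, h2, h3, h4⟩ := exists_gamma_iterate_eq hy (by omega) m (by omega)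
        refine ⟨x ++ [1, 2, 1], Or.inr ⟨x, h1, rfl⟩, ?_⟩
        rw [GK_eq h1 h2, h4]
        simp [List.replicate_succ']

/-! ### Foata's bijection on binary words -/

theorem shiftFactors_of_forall {p : ℕ+ → Bool} {w : Word} (h : ∀ c ∈ w, p c = true) :
    shiftFactors p w = w := by
  induction w with
  | nil => simp [shiftFactors, factors]
  | cons a w ih =>
    have := shiftFactors_append_cons p [] a w (by simp) (h a (by simp))
    simp only [List.nil_append] at this
    rw [this, ih fun c hc => h c (by simp [hc])]
    simp

/-- Shifting moves the last letter of each factor in front of it, so that in a binary word every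
letter at which the word is cut moves in front of the preceding run of the other letter. -/
theorem shiftFactors_append_of_eq {p : ℕ+ → Bool} {b : ℕ+} {w : Word}
    (h : ∀ c ∈ w, p c = true → c = b) (hb : p b = true) :
    shiftFactors p (w ++ [b]) = b :: w := by
  induction hn : w.length using Nat.strong_induction_on generalizing w with
  | _ n ih =>
    obtain ⟨u, c, w', h1, h2, h3, h4⟩ := split_first p (w ++ [b]) (by simp) (by simpa using hb)
    rw [h1, shiftFactors_append_cons p u c _ h2 h3]
    rcases List.eq_nil_or_concat' w' with rfl | ⟨w'', d, rfl⟩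
    · obtain ⟨rfl, h5⟩ := List.append_inj' h1 rfl
      obtain rfl : b = c := by simpa using h5
      simp [shiftFactors, factors]
    · rw [← List.cons_append, ← List.append_assoc] at h1
      obtain ⟨rfl, h5⟩ := List.append_inj' h1 rfl
      obtain rfl : b = d := by simpa using h5
      obtain rfl : c = b := h c (by simp) h3
      rw [ih w''.length (by simp at hn; omega) (fun e he => h e (by simp [he])) rfl]
      simp

theorem phi_apply (v : Word) : phi v = foata v := rfl

@[simp] theorem phi_nil : phi [] = [] := rfl

theorem phi_concat (v : Word) (a : ℕ+) : ∃ s, phi (v ++ [a]) = s ++ [a] := by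
  rw [phi_apply, foata_concat, foataStep]
  split
  · exact ⟨[], rfl⟩
  · exact ⟨_, rfl⟩

theorem one_lt_two_pnat : (1 : ℕ+) < 2 := by decide

/-- Every letter is at most two, so all factors are single letters. The hypothesis concerns `phi v`
because these rules are what proves that `phi` preserves binary words. -/
theorem phi_concat_two_of_isBinary_phi {v : Word} (h : IsBinary (phi v)) :
    phi (v ++ [2]) = phi v ++ [2] := by
  rw [phi_apply, foata_concat, foataStep, ← phi_apply]
  split
  · rename_i h1
    simp at h1
    simp [h1]
  · rename_i b h1
    have hle : ∀ c ∈ phi v, c ≤ 2 := by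
      intro c hc
      rcases h c hc with rfl | rfl
      · exact one_lt_two_pnat.le
      · exact le_rfl
    rw [if_pos (hle b (List.mem_of_getLast? h1)), shiftFactors_of_forall]
    simpa using hle

theorem phi_concat_one_one (v : Word) :
    phi (v ++ [1, 1]) = 1 :: phi (v ++ [1]) := by
  obtain ⟨s, hs⟩ := phi_concat v 1
  rw [List.append_cons, phi_apply, foata_concat, foataStep, ← phi_apply, hs]
  simp only [List.getLast?_concat, le_refl, if_true]
  rw [shiftFactors_append_of_eq _ (by simp)]
  · simp
  · intro c _ hc
    exact le_antisymm (by simpa using hc) one_le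

theorem phi_concat_two_one_of_isBinary_phi {v : Word} (h : IsBinary (phi v)) :
    phi (v ++ [2, 1]) = 2 :: phi v ++ [1] := by
  rw [List.append_cons, phi_apply, foata_concat, foataStep, ← phi_apply,
    phi_concat_two_of_isBinary_phi h]
  simp only [List.getLast?_concat, if_neg one_lt_two_pnat.not_ge]
  rw [shiftFactors_append_of_eq _ (by simp)]
  intro c hc hc'
  rcases h c hc with rfl | rfl
  · simp at hc'
  · rfl

@[simp] theorem phi_one : phi [1] = [1] := rfl

theorem isBinary_and_height_phi {v : Word} (hv : IsBinary v) :
    IsBinary (phi v) ∧ height (phi v) = height v := by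
  induction hn : v.length using Nat.strong_induction_on generalizing v with
  | _ n ih =>
    rcases List.eq_nil_or_concat' v with rfl | ⟨u, a, rfl⟩
    · simp
    obtain ⟨hu, ha⟩ : IsBinary u ∧ (a = 1 ∨ a = 2) := by simpa using hv
    have ihu := ih u.length (by simp at hn; omega) hu rfl
    rcases ha with rfl | rfl
    · rcases List.eq_nil_or_concat' u with rfl | ⟨u, b, rfl⟩
      · simp
      obtain ⟨hu', hb⟩ : IsBinary u ∧ (b = 1 ∨ b = 2) := by simpa using hu
      rw [← List.append_cons]
      rcases hb with rfl | rfl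
      · rw [phi_concat_one_one, height_one_cons, ihu.2]
        refine ⟨by simpa using ihu.1, ?_⟩
        simp
        ring
      · have := ih u.length (by simp at hn; omega) hu' rfl
        rw [phi_concat_two_one_of_isBinary_phi this.1]
        refine ⟨by simpa using this.1, ?_⟩
        simp [this.2]
    · rw [phi_concat_two_of_isBinary_phi ihu.1]
      refine ⟨by simpa using ihu.1, ?_⟩
      simp [ihu.2]

theorem isBinary_phi {v : Word} (hv : IsBinary v) : IsBinary (phi v) :=
  (isBinary_and_height_phi hv).1

theorem height_phi {v : Word} (hv : IsBinary v) : height (phi v) = height v :=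
  (isBinary_and_height_phi hv).2

theorem phi_concat_two {v : Word} (h : IsBinary v) : phi (v ++ [2]) = phi v ++ [2] :=
  phi_concat_two_of_isBinary_phi (isBinary_phi h)

theorem phi_concat_two_one {v : Word} (h : IsBinary v) :
    phi (v ++ [2, 1]) = 2 :: phi v ++ [1] :=
  phi_concat_two_one_of_isBinary_phi (isBinary_phi h)

theorem phi_append_replicate_two {v : Word} (h : IsBinary v) (m : ℕ) :
    phi (v ++ List.replicate m 2) = phi v ++ List.replicate m 2 := by
  induction m with
  | zero => simp
  | succ m ih =>
    rw [List.replicate_succ', ← List.append_assoc, phi_concat_two (by simp [h]), ih,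
      List.append_assoc]

/-- Surjectivity of `phi` alone does not give a binary preimage. The first and last letters of `z`
tell which of the three rules to invert. -/
theorem exists_phi_eq {z : Word} (hz : IsBinary z) : ∃ v, IsBinary v ∧ phi v = z := by
  induction hn : z.length using Nat.strong_induction_on generalizing z with
  | _ n ih =>
    rcases List.eq_nil_or_concat' z with rfl | ⟨y, a, rfl⟩
    · exact ⟨[], by simp⟩
    obtain ⟨hy, ha⟩ : IsBinary y ∧ (a = 1 ∨ a = 2) := by simpa using hz
    rcases ha with rfl | rfl
    · rcases y with _ | ⟨b, y⟩
      · exact ⟨[1], by simp⟩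
      obtain ⟨hb, hy'⟩ := isBinary_cons.1 hy
      rcases hb with rfl | rfl
      · obtain ⟨v, hv, h1⟩ := ih (y.length + 1) (by simp at hn; omega)
          (z := y ++ [1]) (by simp [hy']) (by simp)
        rcases List.eq_nil_or_concat' v with rfl | ⟨u, c, rfl⟩
        · simp at h1
        obtain ⟨s, hs⟩ := phi_concat u c
        obtain rfl : c = 1 := by
          rw [h1] at hs
          simpa using (List.append_inj' hs rfl).2.symm
        have hu := (isBinary_append.1 hv).1
        exact ⟨u ++ [1, 1], by simp [hu], by rw [phi_concat_one_one, h1]; rfl⟩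
      · obtain ⟨v, hv, rfl⟩ := ih y.length (by simp at hn; omega) hy' rfl
        exact ⟨v ++ [2, 1], by simp [hv], phi_concat_two_one hv⟩
    · obtain ⟨v, hv, rfl⟩ := ih y.length (by simp at hn; omega) hy rfl
      exact ⟨v ++ [2], by simp [hv], phi_concat_two hv⟩

/-- The number of factors `21`. -/
def descents : Word → ℕ
  | [] => 0
  | a :: w => (if a = 2 ∧ w.head? = some 1 then 1 else 0) + descents w

theorem descents_append_le (u w : Word) : descents w ≤ descents (u ++ w) := by
  induction u with
  | nil => simp
  | cons a u ih => exact ih.trans (by simp [descents])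

theorem descents_two_one_cons (w : Word) : descents (2 :: 1 :: w) = descents w + 1 := by
  simp [descents, show (1 : ℕ+) ≠ 2 by decide]
  omega

theorem descents_concat_two (w : Word) : descents (w ++ [2]) = descents w := by
  induction w with
  | nil => simp [descents]
  | cons a w ih =>
    cases w with
    | nil => simp [descents, show (2 : ℕ+) ≠ 1 by decide]
    | cons b w => simp [descents] at ih ⊢; simp [ih]

theorem descents_concat_one_one (w : Word) : descents (w ++ [1, 1]) = descents (w ++ [1]) := by
  induction w with
  | nil => simp [descents, show (1 : ℕ+) ≠ 2 by decide]
  | cons a w ih =>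
    cases w with
    | nil => simp [descents]
    | cons b w => simp [descents] at ih ⊢; simp [ih]

theorem descents_concat_two_one (w : Word) : descents (w ++ [2, 1]) = descents w + 1 := by
  induction w with
  | nil => simp [descents, show (1 : ℕ+) ≠ 2 by decide]
  | cons a w ih =>
    cases w with
    | nil => simp [descents, show (2 : ℕ+) ≠ 1 by decide, show (1 : ℕ+) ≠ 2 by decide]
    | cons b w => simp [descents] at ih ⊢; omega

/-- Descents are indexed from the right, since the last descent supplies the outermost wrapping and
hence the first row and column. -/
theorem exists_descent {w : Word} {k : ℕ} (h : k < descents w) :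
    ∃ y s, w = y ++ 2 :: 1 :: s ∧ descents s = k := by
  induction w with
  | nil => simp [descents] at h
  | cons a w ih =>
    by_cases hk : k < descents w
    · obtain ⟨y, s, rfl, hs⟩ := ih hk
      exact ⟨a :: y, s, rfl, hs⟩
    · by_cases ha : a = 2 ∧ w.head? = some 1
      · obtain ⟨rfl, hw⟩ := ha
        obtain ⟨s, rfl⟩ := List.head?_eq_some_iff.1 hw
        rw [descents_two_one_cons] at h
        have := descents_append_le [1] s
        simp at this
        exact ⟨[], s, rfl, by omega⟩
      · simp [descents, ha] at h
        exact absurd h hk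

/-- Letters appended to a word which is empty or ends in a one surround the image of that
word. -/
theorem exists_phi_append {s : Word} (hs : IsBinary s) : ∃ l r : Word,
    l.count 2 = descents s ∧ r.count 1 = descents s ∧ IsBinary l ∧ IsBinary r ∧
      ∀ x, IsBinary x → x = [] ∨ (∃ y, x = y ++ [1]) → phi (x ++ s) = l ++ phi x ++ r := by
  have h12 : (1 : ℕ+) ≠ 2 := by decide
  induction hn : s.length using Nat.strong_induction_on generalizing s with
  | _ n ih =>
    rcases List.eq_nil_or_concat' s with rfl | ⟨u, a, rfl⟩
    · exact ⟨[], [], by simp [descents]⟩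
    obtain ⟨hu, ha⟩ : IsBinary u ∧ (a = 1 ∨ a = 2) := by simpa using hs
    obtain ⟨l, r, h1, h2, h3, h4, h5⟩ := ih u.length (by simp at hn; omega) hu rfl
    rcases ha with rfl | rfl
    · rcases List.eq_nil_or_concat' u with rfl | ⟨u, b, rfl⟩
      -- Only here does the last letter of `x` matter: after a one, or after nothing, an appended
      -- one amounts to a one in front.
      · refine ⟨[1], [], by simp [descents, h12], by simp [descents, h12], by simp, by simp, ?_⟩
        rintro x hx (rfl | ⟨y, rfl⟩)
        · simp
        · have := phi_concat_one_one y
          simpa using this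
      obtain ⟨hu', hb⟩ : IsBinary u ∧ (b = 1 ∨ b = 2) := by simpa using hu
      rw [← List.append_cons]
      rcases hb with rfl | rfl
      · refine ⟨1 :: l, r, ?_, ?_, by simp [h3], h4, ?_⟩
        · rw [descents_concat_one_one, ← h1]
          simp [h12]
        · rw [descents_concat_one_one, h2]
        · intro x hx hx'
          rw [← List.append_assoc, phi_concat_one_one, List.append_assoc,
            h5 x hx hx']
          rfl
      · obtain ⟨l, r, h1, h2, h3, h4, h5⟩ := ih u.length (by simp at hn; omega) hu' rfl
        refine ⟨2 :: l, r ++ [1], ?_, ?_, by simp [h3], by simp [h4], ?_⟩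
        · rw [descents_concat_two_one, ← h1]
          simp
        · rw [descents_concat_two_one, ← h2]
          simp
        · intro x hx hx'
          rw [← List.append_assoc, phi_concat_two_one (by simp [hx, hu']), h5 x hx hx']
          simp
    · refine ⟨l, r ++ [2], ?_, ?_, h3, by simp [h4], ?_⟩
      · rw [descents_concat_two, h1]
      · rw [descents_concat_two, ← h2]
        simp [h12.symm]
      · intro x hx hx'
        rw [← List.append_assoc, phi_concat_two (by simp [hx, hu]), h5 x hx hx']
        simp

/-! ### The diagram below a lattice path -/

theorem youngDiagram_ext_colLen {lam mu : YoungDiagram} (h : ∀ j, lam.colLen j = mu.colLen j) :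
    lam = mu := by
  ext ⟨i, j⟩
  rw [YoungDiagram.mem_cells, YoungDiagram.mem_cells, YoungDiagram.mem_iff_lt_colLen,
    YoungDiagram.mem_iff_lt_colLen, h]

theorem rowLen_eq_of_forall_mem {lam : YoungDiagram} {i n : ℕ}
    (h : ∀ j, (i, j) ∈ lam ↔ j < n) : lam.rowLen i = n :=
  eq_of_forall_lt_iff fun j => by rw [← YoungDiagram.mem_iff_lt_rowLen, h]

theorem colLen_eq_of_forall_mem {lam : YoungDiagram} {j n : ℕ}
    (h : ∀ i, (i, j) ∈ lam ↔ i < n) : lam.colLen j = n :=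
  eq_of_forall_lt_iff fun i => by rw [← YoungDiagram.mem_iff_lt_colLen, h]

open Classical in
/-- The Young diagram whose southeast boundary is described by a word, a one being a north step and
a two an east step: a cell belongs to it if some point of the path lies strictly southeast of its
northwest corner. -/
noncomputable def diagram (z : Word) : YoungDiagram where
  cells := {c ∈ Finset.range z.length ×ˢ Finset.range z.length |
    ∃ p s : Word, z = p ++ s ∧ c.2 < p.count 2 ∧ c.1 < s.count 1}
  isLowerSet := by
    rintro ⟨i, j⟩ ⟨i', j'⟩ h hc
    obtain ⟨h1, h2⟩ : i' ≤ i ∧ j' ≤ j := h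
    simp only [Finset.coe_filter, Finset.mem_product, Finset.mem_range, Set.mem_ofPred_eq] at hc ⊢
    obtain ⟨⟨h3, h4⟩, p, s, h5, h6, h7⟩ := hc
    exact ⟨⟨by omega, by omega⟩, p, s, h5, by omega, by omega⟩

theorem mem_diagram {z : Word} {i j : ℕ} :
    (i, j) ∈ diagram z ↔ ∃ p s : Word, z = p ++ s ∧ j < p.count 2 ∧ i < s.count 1 := by
  rw [← YoungDiagram.mem_cells]
  simp only [diagram, Finset.mem_filter, Finset.mem_product, Finset.mem_range,
    and_iff_right_iff_imp]
  rintro ⟨p, s, rfl, h1, h2⟩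
  have h3 : p.count 2 ≤ p.length := List.count_le_length
  have h4 : s.count 1 ≤ s.length := List.count_le_length
  simp
  omega

theorem mem_diagram_append {p s : Word} {i j : ℕ} (hj : j < p.count 2) (hi : i < s.count 1) :
    (i, j) ∈ diagram (p ++ s) :=
  mem_diagram.2 ⟨p, s, rfl, hj, hi⟩

/-- Any other point of the path has either no more twos before it or no more ones after it, so no
point of the path lies strictly southeast of the cell's northwest corner. -/
theorem notMem_diagram_append {p s : Word} {i j : ℕ} (hj : p.count 2 ≤ j) (hi : s.count 1 ≤ i) :
    (i, j) ∉ diagram (p ++ s) := by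
  rw [mem_diagram]
  rintro ⟨p', s', h, h1, h2⟩
  rcases List.append_eq_append_iff.1 h with ⟨t, rfl, rfl⟩ | ⟨t, rfl, rfl⟩
  · simp at hi
    omega
  · simp at hj
    omega

theorem rowLen_diagram (p s : Word) : (diagram (p ++ 1 :: s)).rowLen (s.count 1) = p.count 2 := by
  refine rowLen_eq_of_forall_mem fun j => ⟨fun h => ?_, fun h => mem_diagram_append h (by simp)⟩
  contrapose! h
  rw [List.append_cons]
  exact notMem_diagram_append (by simpa [show (1 : ℕ+) ≠ 2 by decide] using h) le_rfl

theorem colLen_diagram (p s : Word) : (diagram (p ++ 2 :: s)).colLen (p.count 2) = s.count 1 := by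
  refine colLen_eq_of_forall_mem fun i => ⟨fun h => ?_, fun h => ?_⟩
  · contrapose! h
    exact notMem_diagram_append le_rfl (by simpa [show (2 : ℕ+) ≠ 1 by decide] using h)
  · rw [List.append_cons]
    exact mem_diagram_append (by simp) h

/-- The reflection of a lattice path. -/
def reflect (z : Word) : Word := (z.map (Equiv.swap 1 2)).reverse

@[simp] theorem reflect_reflect (z : Word) : reflect (reflect z) = z := by
  simp [reflect, Function.comp_def]

@[simp] theorem reflect_append (u w : Word) : reflect (u ++ w) = reflect w ++ reflect u := by
  simp [reflect]

@[simp] theorem count_one_reflect (z : Word) : (reflect z).count 1 = z.count 2 := by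
  have := List.count_map_of_injective z _ (Equiv.swap (1 : ℕ+) 2).injective 2
  simpa [reflect] using this

@[simp] theorem count_two_reflect (z : Word) : (reflect z).count 2 = z.count 1 := by
  have := List.count_map_of_injective z _ (Equiv.swap (1 : ℕ+) 2).injective 1
  simpa [reflect] using this

theorem transpose_diagram (z : Word) : (diagram z).transpose = diagram (reflect z) := by
  ext ⟨i, j⟩
  rw [YoungDiagram.mem_cells, YoungDiagram.mem_cells, YoungDiagram.mem_transpose, Prod.swap,
    mem_diagram, mem_diagram]
  constructor
  · rintro ⟨p, s, rfl, h1, h2⟩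
    exact ⟨reflect s, reflect p, by simp, by simpa using h2, by simpa using h1⟩
  · rintro ⟨p, s, h, h1, h2⟩
    refine ⟨reflect s, reflect p, ?_, by simpa using h2, by simpa using h1⟩
    rw [← reflect_append, ← h, reflect_reflect]

/-- The number of ones after the two with index `j`. -/
def onesAfter : Word → ℕ → ℕ
  | [], _ => 0
  | a :: w, j => if a = 2 then (if j = 0 then w.count 1 else onesAfter w (j - 1)) else onesAfter w j

theorem onesAfter_eq_zero {w : Word} {j : ℕ} (h : w.count 2 ≤ j) : onesAfter w j = 0 := by
  induction w generalizing j with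
  | nil => rfl
  | cons a w ih =>
    by_cases ha : a = 2
    · subst ha
      simp at h
      simp [onesAfter, show j ≠ 0 by omega, ih (show w.count 2 ≤ j - 1 by omega)]
    · simp [ha] at h
      simp [onesAfter, ha, ih h]

theorem onesAfter_append (u w : Word) (j : ℕ) : onesAfter (u ++ w) j =
    if j < u.count 2 then onesAfter u j + w.count 1 else onesAfter w (j - u.count 2) := by
  induction u generalizing j with
  | nil => simp
  | cons a u ih =>
    by_cases ha : a = 2
    · subst ha
      by_cases hj : j = 0
      · simp [onesAfter, hj]
      · simp only [List.cons_append, onesAfter, hj, if_true, if_false, ih, List.count_cons_self]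
        rw [show j - 1 - u.count 2 = j - (u.count 2 + 1) by omega]
        simp only [show j - 1 < u.count 2 ↔ j < u.count 2 + 1 by omega]
    · simp [onesAfter, ha, ih]

theorem colLen_diagram_eq_onesAfter (z : Word) (j : ℕ) :
    (diagram z).colLen j = onesAfter z j := by
  by_cases h : j < z.count 2
  · obtain ⟨p, s, rfl, rfl⟩ : ∃ p s, z = p ++ 2 :: s ∧ p.count 2 = j := by
      induction z generalizing j with
      | nil => simp at h
      | cons a w ih =>
        by_cases ha : a = 2
        · subst ha
          rcases j with _ | j
          · exact ⟨[], w, rfl, rfl⟩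
          · simp at h
            obtain ⟨p, s, rfl, rfl⟩ := ih j h
            exact ⟨2 :: p, s, rfl, by simp⟩
        · simp [ha] at h
          obtain ⟨p, s, rfl, rfl⟩ := ih j h
          exact ⟨a :: p, s, rfl, by simp [ha]⟩
    rw [colLen_diagram, onesAfter_append]
    simp [onesAfter]
  · rw [onesAfter_eq_zero (by omega)]
    refine colLen_eq_of_forall_mem fun i => ?_
    have := notMem_diagram_append (p := z) (s := []) (i := i) (j := j) (by omega) (by simp)
    simpa using this

/-- Comparing diagrams by column lengths turns the insertion of a row into adding an indicator
function, wherever the row is placed. -/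
theorem colLen_diagram_insert_one (p s : Word) (j : ℕ) :
    (diagram (p ++ 1 :: s)).colLen j =
      (diagram (p ++ s)).colLen j + if j < p.count 2 then 1 else 0 := by
  simp only [colLen_diagram_eq_onesAfter, onesAfter_append]
  split_ifs
  · simp [add_assoc]
  · simp [onesAfter, show (1 : ℕ+) ≠ 2 by decide]

theorem diagram_concat_two (z : Word) : diagram (z ++ [2]) = diagram z := by
  refine youngDiagram_ext_colLen fun j => ?_
  simp only [colLen_diagram_eq_onesAfter, onesAfter_append]
  split_ifs with h
  · simp
  · rw [onesAfter_eq_zero (not_lt.1 h)]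
    simp [onesAfter]

/-! ### Partitions and their parts -/

/-- In a weakly decreasing list the entries above `j` form an initial segment. -/
theorem lt_countP_iff {l : List ℕ} (hl : l.SortedGE) (i j : ℕ) :
    i < l.countP (fun b => decide (j < b)) ↔ ∃ h : i < l.length, j < l[i] := by
  induction l generalizing i with
  | nil => simp
  | cons a l ih =>
    have hl' := List.pairwise_cons.1 hl.pairwise
    by_cases ha : j < a
    · rcases i with _ | i
      · simp [ha]
      · simp [ha, ih hl'.2.sortedGE]
    · have h0 : l.countP (fun b => decide (j < b)) = 0 := by
        rw [List.countP_eq_zero]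
        intro b hb
        have := hl'.1 b hb
        simp
        omega
      simp only [List.countP_cons, h0, ha, decide_false, Bool.false_eq_true, if_false, add_zero,
        not_lt_zero, false_iff, not_exists, not_lt]
      intro h
      rcases i with _ | i
      · simpa using ha
      · have := hl'.1 (l[i]'(by simpa using h)) (List.getElem_mem _)
        simp
        omega

/-- A count of large parts ignores their order, so the multiset operations in `kappa` become
arithmetic with column lengths. -/
theorem colLen_ofParts (m : Multiset ℕ) (j : ℕ) :
    (ofParts m).colLen j = m.countP (fun b => j < b) := by
  refine colLen_eq_of_forall_mem fun i => ?_
  have h : (m.sort (· ≥ ·) : Multiset ℕ) = m := Multiset.sort_eq m _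
  conv_rhs => rw [← h, Multiset.coe_countP]
  rw [lt_countP_iff (Multiset.pairwise_sort m (· ≥ ·)).sortedGE, ofParts,
    YoungDiagram.mem_ofRowLens]

theorem ofParts_parts (lam : YoungDiagram) : ofParts (parts lam) = lam := by
  have h : ((parts lam).sort (· ≥ ·)) = lam.rowLens :=
    List.Perm.eq_of_pairwise' (Multiset.pairwise_sort _ _) lam.rowLens_sorted.pairwise
      (Multiset.coe_eq_coe.1 (Multiset.sort_eq _ _))
  simp only [ofParts, h, YoungDiagram.ofRowLens_to_rowLens_eq_self]

theorem countP_parts (lam : YoungDiagram) (j : ℕ) :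
    (parts lam).countP (fun b => j < b) = lam.colLen j := by
  rw [← colLen_ofParts, ofParts_parts]

theorem rowLen_mem_parts {lam : YoungDiagram} {i : ℕ} (h : 0 < lam.rowLen i) :
    lam.rowLen i ∈ parts lam := by
  rw [← YoungDiagram.mem_iff_lt_rowLen, YoungDiagram.mem_iff_lt_colLen] at h
  simp only [parts, YoungDiagram.rowLens, Multiset.mem_coe, List.mem_map, List.mem_range]
  exact ⟨i, h, rfl⟩

theorem countP_parts_erase {lam : YoungDiagram} {k : ℕ} (h : k ∈ parts lam) (j : ℕ) :
    ((parts lam).erase k).countP (fun b => j < b) + (if j < k then 1 else 0) = lam.colLen j := by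
  rw [← countP_parts, ← Multiset.cons_erase h, Multiset.countP_cons, Multiset.erase_cons_head]

theorem addPart_diagram (p s : Word) :
    addPart (p.count 2) (diagram (p ++ s)) = diagram (p ++ 1 :: s) := by
  refine youngDiagram_ext_colLen fun j => ?_
  rw [addPart, colLen_ofParts, Multiset.countP_cons, countP_parts, colLen_diagram_insert_one]

theorem growFirst_diagram (p : Word) :
    growFirst (diagram (p ++ [1])) = diagram (p ++ [2, 1]) := by
  have h1 : (diagram (p ++ [1])).rowLen 0 = p.count 2 := rowLen_diagram p []
  refine youngDiagram_ext_colLen fun j => ?_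
  rw [growFirst, colLen_ofParts, Multiset.countP_cons, h1,
    show p ++ [2, 1] = p ++ [2] ++ 1 :: [] by simp, colLen_diagram_insert_one, List.append_nil,
    diagram_concat_two]
  have h2 := colLen_diagram_insert_one p [] j
  rw [List.append_nil] at h2
  simp only [List.count_append, List.count_singleton_self]
  -- Without twos the first row has length zero, which is not a part: the erasure does nothing and a
  -- new part of size one appears.
  by_cases h3 : p.count 2 = 0
  · rw [h3] at h2 ⊢
    have h4 : 0 ∉ parts (diagram (p ++ [1])) := fun h =>
      lt_irrefl _ (YoungDiagram.pos_of_mem_rowLens _ _ h)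
    rw [Multiset.erase_of_notMem h4, countP_parts]
    simp [h2]
  · have := countP_parts_erase (h1 ▸ rowLen_mem_parts (by omega)) j
    rw [← this] at h2
    omega

theorem ofParts_erase_diagram {p : Word} (s : Word) (h : 0 < p.count 2) :
    p.count 2 ∈ parts (diagram (p ++ 1 :: s)) ∧
      ofParts ((parts (diagram (p ++ 1 :: s))).erase (p.count 2)) = diagram (p ++ s) := by
  have h1 := rowLen_diagram p s
  have h2 : p.count 2 ∈ parts (diagram (p ++ 1 :: s)) := by
    rw [← h1] at h ⊢
    exact rowLen_mem_parts h
  refine ⟨h2, youngDiagram_ext_colLen fun j => ?_⟩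
  have h3 := countP_parts_erase h2 j
  rw [colLen_diagram_insert_one] at h3
  rw [colLen_ofParts]
  omega

theorem removeConjPart_diagram (p : Word) {s : Word} (h : 0 < s.count 1) :
    s.count 1 ∈ parts (diagram (p ++ 2 :: s)).transpose ∧
      removeConjPart (s.count 1) (diagram (p ++ 2 :: s)) = diagram (p ++ s) := by
  have h1 := ofParts_erase_diagram (p := reflect s) (reflect p) (by simpa using h)
  have h2 : reflect (p ++ 2 :: s) = reflect s ++ 1 :: reflect p := by
    simp [reflect]
  rw [removeConjPart, transpose_diagram, h2]
  rw [count_two_reflect] at h1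
  refine ⟨h1.1, ?_⟩
  rw [h1.2, transpose_diagram]
  simp

/-! ### The boundary word -/

/-- The part of the boundary word that describes the first `n` rows. -/
def boundarySuffix (lam : YoungDiagram) (n : ℕ) : Word :=
  (List.range n).reverse.flatMap fun i =>
    List.replicate (lam.rowLen i - lam.rowLen (i + 1)) 2 ++ [1]

theorem boundaryWord_eq (lam : YoungDiagram) :
    boundaryWord lam = boundarySuffix lam (lam.colLen 0) := rfl

@[simp] theorem boundarySuffix_zero (lam : YoungDiagram) : boundarySuffix lam 0 = [] := rfl

theorem boundarySuffix_succ (lam : YoungDiagram) (n : ℕ) : boundarySuffix lam (n + 1) =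
    List.replicate (lam.rowLen n - lam.rowLen (n + 1)) 2 ++ 1 :: boundarySuffix lam n := by
  simp [boundarySuffix, List.range_succ]

theorem count_one_boundarySuffix (lam : YoungDiagram) (n : ℕ) :
    (boundarySuffix lam n).count 1 = n := by
  induction n with
  | zero => simp
  | succ n ih =>
    simp [boundarySuffix_succ, ih, List.count_replicate]

theorem isBinary_boundarySuffix (lam : YoungDiagram) (n : ℕ) :
    IsBinary (boundarySuffix lam n) := by
  induction n with
  | zero => simp
  | succ n ih => simp [boundarySuffix_succ, ih]

theorem exists_boundarySuffix_eq (lam : YoungDiagram) {i n : ℕ} (h : i < n) :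
    ∃ p, boundarySuffix lam n = p ++ 1 :: boundarySuffix lam i ∧
      p.count 2 + lam.rowLen n = lam.rowLen i := by
  induction n, h using Nat.le_induction with
  | base =>
    refine ⟨_, boundarySuffix_succ lam i, ?_⟩
    have := lam.rowLen_anti i (i + 1) (by omega)
    simp
    omega
  | succ n _ ih =>
    obtain ⟨p, h1, h2⟩ := ih
    have := lam.rowLen_anti n (n + 1) (by omega)
    refine ⟨List.replicate (lam.rowLen n - lam.rowLen (n + 1)) 2 ++ 1 :: p, ?_, ?_⟩
    · rw [boundarySuffix_succ, h1]
      simp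
    · simp [show (1 : ℕ+) ≠ 2 by decide]
      omega

theorem rowLen_colLen_zero (lam : YoungDiagram) : lam.rowLen (lam.colLen 0) = 0 := by
  by_contra h
  have := YoungDiagram.mem_iff_lt_rowLen.2 (Nat.pos_of_ne_zero h)
  rw [YoungDiagram.mem_iff_lt_colLen] at this
  omega

theorem diagram_boundaryWord (lam : YoungDiagram) : diagram (boundaryWord lam) = lam := by
  ext ⟨i, j⟩
  rw [YoungDiagram.mem_cells, YoungDiagram.mem_cells, YoungDiagram.mem_iff_lt_rowLen,
    YoungDiagram.mem_iff_lt_rowLen]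
  have h0 := rowLen_colLen_zero lam
  by_cases h : i < lam.colLen 0
  · obtain ⟨p, h1, h2⟩ := exists_boundarySuffix_eq lam h
    have h3 := rowLen_diagram p (boundarySuffix lam i)
    rw [count_one_boundarySuffix] at h3
    rw [boundaryWord_eq, h1, h3]
    omega
  · have h1 := lam.rowLen_anti (lam.colLen 0) i (by omega)
    have h2 := notMem_diagram_append (p := []) (s := boundaryWord lam) (i := i) (j := j) (by simp)
      (by rw [boundaryWord_eq, count_one_boundarySuffix]; omega)
    rw [List.nil_append, YoungDiagram.mem_iff_lt_rowLen] at h2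
    omega

theorem boundaryWord_injective : Function.Injective boundaryWord :=
  Function.LeftInverse.injective diagram_boundaryWord

/-- The binary words that begin with a two and end with a one, and the empty word. -/
def IsBoundary (z : Word) : Prop := z = [] ∨ ∃ y, IsBinary y ∧ z = 2 :: y ++ [1]

theorem IsBoundary.isBinary {z : Word} (h : IsBoundary z) : IsBinary z := by
  obtain rfl | ⟨y, hy, rfl⟩ := h <;> simp [*]

theorem isBoundary_boundaryWord (lam : YoungDiagram) : IsBoundary (boundaryWord lam) := by
  rcases hn : lam.colLen 0 with _ | n
  · exact Or.inl (by rw [boundaryWord_eq, hn]; rfl)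
  · have h1 : 0 < lam.rowLen n := by
      rw [← YoungDiagram.mem_iff_lt_rowLen, YoungDiagram.mem_iff_lt_colLen]
      omega
    have h2 := rowLen_colLen_zero lam
    rw [hn] at h2
    obtain ⟨k, hk⟩ := Nat.exists_eq_add_of_lt h1
    have h3 := boundarySuffix_succ lam n
    rw [h2, hk, Nat.sub_zero, zero_add, List.replicate_succ, ← hn, ← boundaryWord_eq] at h3
    obtain ⟨p, hp, -⟩ := exists_boundarySuffix_eq lam (show 0 < lam.colLen 0 by omega)
    rw [← boundaryWord_eq, boundarySuffix_zero] at hp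
    have h4 := isBinary_boundarySuffix lam (lam.colLen 0)
    rw [← boundaryWord_eq] at h4
    rcases p with _ | ⟨a, p⟩
    · rw [hp] at h3
      simp at h3
    · rw [hp] at h3 h4
      obtain ⟨rfl, -⟩ := List.cons.inj h3
      rw [hp]
      exact Or.inr ⟨p, by simpa using h4, rfl⟩

theorem colLen_zero_diagram {z : Word} (hz : IsBoundary z) :
    (diagram z).colLen 0 = z.count 1 := by
  obtain rfl | ⟨y, -, rfl⟩ := hz
  · rw [colLen_diagram_eq_onesAfter]
    rfl
  · have := colLen_diagram [] (y ++ [1])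
    simpa using this

/-- Compare letter by letter, moving the common letters into `u`. At a first difference, equal
numbers of ones put both steps at the same lattice point, and the cell southeast of the north step's
upper end lies in only one diagram. -/
theorem eq_of_diagram_append_eq {w w' : Word} (u : Word) (hw : IsBinary w) (hw' : IsBinary w')
    (h1 : w = [] ∨ ∃ y, w = y ++ [1]) (h1' : w' = [] ∨ ∃ y, w' = y ++ [1])
    (hc : w.count 1 = w'.count 1) (h : diagram (u ++ w) = diagram (u ++ w')) : w = w' := by
  have key : ∀ u s s' : Word, (1 :: s).count 1 = (2 :: s').count 1 →
      diagram (u ++ 1 :: s) ≠ diagram (u ++ 2 :: s') := by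
    intro u s s' hc h
    have h2 := rowLen_diagram u s
    have h3 := colLen_diagram u s'
    rw [← h] at h3
    have h4 : (s.count 1, u.count 2) ∈ diagram (u ++ 1 :: s) := by
      rw [YoungDiagram.mem_iff_lt_colLen, h3]
      simp [show (2 : ℕ+) ≠ 1 by decide] at hc
      omega
    rw [YoungDiagram.mem_iff_lt_rowLen, h2] at h4
    omega
  induction w generalizing u w' with
  | nil =>
    obtain rfl | ⟨y, rfl⟩ := h1'
    · rfl
    · simp at hc
  | cons a w ih =>
    rcases w' with _ | ⟨a', w'⟩
    · obtain h1 | ⟨y, h1⟩ := h1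
      · simp at h1
      · rw [h1] at hc
        simp at hc
    · obtain ⟨ha, hv⟩ := isBinary_cons.1 hw
      obtain ⟨ha', hv'⟩ := isBinary_cons.1 hw'
      have hend : ∀ {b : ℕ+} {v : Word}, (b :: v = [] ∨ ∃ y, b :: v = y ++ [1]) →
          v = [] ∨ ∃ y, v = y ++ [1] := by
        rintro b v (h | ⟨_ | ⟨c, y⟩, h⟩)
        · simp at h
        · simp at h
          exact Or.inl h.2
        · exact Or.inr ⟨y, (List.cons.inj h).2⟩
      obtain rfl : a = a' := by
        rcases ha with rfl | rfl <;> rcases ha' with rfl | rfl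
        · rfl
        · exact (key _ _ _ hc h).elim
        · exact (key _ _ _ hc.symm h.symm).elim
        · rfl
      rw [ih (u ++ [a]) hv hv' (hend h1) (hend h1') (by simpa [List.count_cons] using hc)
        (by simpa using h)]

theorem boundaryWord_diagram {z : Word} (hz : IsBoundary z) : boundaryWord (diagram z) = z := by
  have hb := isBoundary_boundaryWord (diagram z)
  have hend : ∀ {z : Word}, IsBoundary z → z = [] ∨ ∃ y, z = y ++ [1] := by
    rintro z (rfl | ⟨y, -, rfl⟩)
    · exact Or.inl rfl
    · exact Or.inr ⟨2 :: y, rfl⟩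
  refine eq_of_diagram_append_eq [] hb.isBinary hz.isBinary (hend hb) (hend hz) ?_ ?_
  · rw [← colLen_zero_diagram hb, ← colLen_zero_diagram hz, diagram_boundaryWord]
  · exact diagram_boundaryWord _

/-! ### Images of the sets of partitions -/

theorem image_boundaryWord_D_zero :
    boundaryWord '' D 0 = {z | z = [] ∨ ∃ y, IsBinary y ∧ z = 2 :: y ++ [1, 1]} := by
  ext z
  constructor
  · rintro ⟨lam, hl, rfl⟩
    obtain h | ⟨y, hy, h⟩ := isBoundary_boundaryWord lam
    · exact Or.inl h
    · have hl : lam.rowLen 0 = lam.rowLen 1 := hl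
      have h1 := rowLen_diagram (2 :: y) []
      rw [← h, diagram_boundaryWord] at h1
      rcases List.eq_nil_or_concat' (2 :: y) with h2 | ⟨u, a, h2⟩
      · simp at h2
      obtain rfl | rfl : a = 1 ∨ a = 2 := by
        have : IsBinary (2 :: y) := by simp [hy]
        rw [h2] at this
        simpa using (isBinary_append.1 this).2
      · rcases u with _ | ⟨b, u⟩
        · simp at h2
        · obtain ⟨rfl, rfl⟩ := List.cons.inj h2
          exact Or.inr ⟨u, (isBinary_append.1 hy).1, by rw [h]; simp⟩
      -- A path ending in `21` makes the first row strictly longer than the second.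
      · have h3 : (1, u.count 2) ∉ diagram (u ++ [2, 1]) :=
          notMem_diagram_append le_rfl (by simp [show (2 : ℕ+) ≠ 1 by decide])
        rw [List.append_cons, ← h2, ← h, diagram_boundaryWord, YoungDiagram.mem_iff_lt_rowLen]
          at h3
        rw [h2] at h1
        simp at h1
        omega
  · rintro (rfl | ⟨y, hy, rfl⟩)
    · refine ⟨diagram [], ?_, boundaryWord_diagram (Or.inl rfl)⟩
      have h : ∀ i, (diagram []).rowLen i = 0 := fun i =>
        rowLen_eq_of_forall_mem fun j => by simp [mem_diagram]
      simp [D, h]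
    · refine ⟨diagram _, ?_, boundaryWord_diagram (Or.inr ⟨y ++ [1], by simp [hy], by simp⟩)⟩
      have h1 := rowLen_diagram (2 :: y) [1]
      have h2 := rowLen_diagram (2 :: y ++ [1]) []
      rw [List.append_assoc] at h2
      simp [show (1 : ℕ+) ≠ 2 by decide] at h1 h2
      simp [D, h1, h2]

theorem bijOn_phi_D : Set.BijOn phi (W [1, 2, 1]) (boundaryWord '' D 0) := by
  rw [image_boundaryWord_D_zero]
  refine ⟨?_, phi.injective.injOn, ?_⟩
  · rintro v (rfl | ⟨x, hx, rfl⟩)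
    · exact Or.inl rfl
    · obtain ⟨s, hs⟩ := phi_concat x 1
      refine Or.inr ⟨s, ?_, ?_⟩
      · have := isBinary_phi (v := x ++ [1]) (by simp [hx])
        rw [hs] at this
        exact (isBinary_append.1 this).1
      · rw [List.append_cons, phi_concat_two_one (by simp [hx]), hs]
        simp
  · rintro z (rfl | ⟨y, hy, rfl⟩)
    · exact ⟨[], Or.inl rfl, rfl⟩
    · obtain ⟨u, hu, h⟩ := exists_phi_eq (z := y ++ [1]) (by simp [hy])
      rcases List.eq_nil_or_concat' u with rfl | ⟨x, a, rfl⟩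
      · simp at h
      obtain ⟨s, hs⟩ := phi_concat x a
      obtain rfl : a = 1 := by
        rw [hs] at h
        simpa using (List.append_inj' h rfl).2
      refine ⟨x ++ [1, 2, 1], Or.inr ⟨x, (isBinary_append.1 hu).1, rfl⟩, ?_⟩
      rw [List.append_cons, phi_concat_two_one hu, h]
      simp

/-! ### Ranks and heights -/

theorem exists_phi_eq_of_descent {y s : Word} (h : IsBinary (y ++ 2 :: 1 :: s)) :
    ∃ l r : Word, l.count 2 = descents s ∧ r.count 1 = descents s ∧
      phi (y ++ 2 :: 1 :: s) = l ++ 2 :: (phi y ++ 1 :: r) := by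
  obtain ⟨hy, hs⟩ : IsBinary y ∧ IsBinary s := by simpa using h
  obtain ⟨l, r, h1, h2, -, -, h3⟩ := exists_phi_append hs
  refine ⟨l, r, h1, h2, ?_⟩
  have := h3 (y ++ [2, 1]) (by simp [hy]) (Or.inr ⟨y ++ [2], by simp⟩)
  rw [phi_concat_two_one hy] at this
  simpa using this

theorem rank_diagram_phi {y s : Word} (h : IsBinary (y ++ 2 :: 1 :: s)) :
    rank (diagram (phi (y ++ 2 :: 1 :: s))) (descents s + 1) = height y := by
  obtain ⟨l, r, h1, h2, h3⟩ := exists_phi_eq_of_descent h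
  have hy : IsBinary y := (isBinary_append.1 h).1
  have h4 := colLen_diagram l (phi y ++ 1 :: r)
  have h5 := rowLen_diagram (l ++ 2 :: phi y) r
  have h6 := height_eq_count (isBinary_phi hy)
  rw [height_phi hy] at h6
  rw [List.append_assoc, List.cons_append] at h5
  rw [← h3] at h4 h5
  rw [h1] at h4
  rw [h2] at h5
  rw [rank, Nat.add_sub_cancel, h4, h5, h6]
  simp [h1, h2]
  ring

theorem durfee_diagram_phi {v : Word} (hv : IsBinary v) : durfee (diagram (phi v)) = descents v := by
  have hmem : ∀ i j, i < descents v → j < descents v → (i, j) ∈ diagram (phi v) := by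
    intro i j hi hj
    obtain ⟨y, s, rfl, hs⟩ := exists_descent (k := descents v - 1) (w := v) (by omega)
    obtain ⟨l, r, h1, h2, h3⟩ := exists_phi_eq_of_descent hv
    rw [h3, List.append_cons]
    apply mem_diagram_append
    · simp
      omega
    · simp
      omega
  rw [durfee, Nat.findGreatest_eq_iff]
  refine ⟨?_, fun _ i hi j hj => hmem i j hi hj, fun d hd _ h => ?_⟩
  -- The search for the Durfee side is bounded by the number of cells; the first column already has
  -- enough of them.
  · have h1 : (Finset.range (descents v)).image (fun i => (i, 0)) ⊆ (diagram (phi v)).cells := by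
      intro c hc
      obtain ⟨i, hi, rfl⟩ := Finset.mem_image.1 hc
      have := Finset.mem_range.1 hi
      exact hmem i 0 this (by omega)
    have h2 := Finset.card_le_card h1
    rwa [Finset.card_image_of_injective _ (fun i j h => (Prod.mk.inj h).1),
      Finset.card_range] at h2
  -- Surrounding the empty word gives `φ(v) = l r`, so the path passes through the corner of the
  -- square of side `descents v`, and no larger square fits.
  · obtain ⟨l, r, h1, h2, -, -, h3⟩ := exists_phi_append hv
    have h4 := h3 [] (by simp) (Or.inl rfl)
    simp at h4
    have := h _ hd _ hd
    rw [h4] at this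
    exact notMem_diagram_append h1.le h2.le this

theorem exists_descent_of_le_durfee {v : Word} (hv : IsBinary v) {i : ℕ} (h1 : 1 ≤ i)
    (h2 : i ≤ durfee (diagram (phi v))) : ∃ y s, v = y ++ 2 :: 1 :: s ∧ i = descents s + 1 := by
  rw [durfee_diagram_phi hv] at h2
  obtain ⟨y, s, h3, h4⟩ := exists_descent (k := i - 1) (w := v) (by omega)
  exact ⟨y, s, h3, by omega⟩

theorem descents_succ_le_durfee {y s : Word} (h : IsBinary (y ++ 2 :: 1 :: s)) :
    descents s + 1 ≤ durfee (diagram (phi (y ++ 2 :: 1 :: s))) := by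
  rw [durfee_diagram_phi h, ← descents_two_one_cons]
  exact descents_append_le _ _

theorem diagram_phi_mem_RLe_iff {v : Word} (hv : IsBinary v) (t : ℤ) :
    diagram (phi v) ∈ RLe t ↔ ∀ y s, v = y ++ 2 :: 1 :: s → height y ≤ t := by
  constructor
  · rintro h y s rfl
    rw [← rank_diagram_phi hv]
    exact h _ (by omega) (descents_succ_le_durfee hv)
  · intro h i h1 h2
    obtain ⟨y, s, rfl, rfl⟩ := exists_descent_of_le_durfee hv h1 h2
    rw [rank_diagram_phi hv]
    exact h y s rfl

/-- In a word ending in a one the rightmost unpaired two is followed by a one, so positive excess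
yields a descent preceded by a nonnegative height. -/
theorem diagram_phi_mem_RLe_neg_one_iff {v : Word} (hv : v = [] ∨ ∃ x, IsBinary x ∧ v = x ++ [1]) :
    diagram (phi v) ∈ RLe (-1) ↔ excess v = 0 := by
  obtain rfl | ⟨x, hx, rfl⟩ := hv
  · rw [diagram_phi_mem_RLe_iff (by simp)]
    simp
  have hb : IsBinary (x ++ [1]) := by simp [hx]
  rw [diagram_phi_mem_RLe_iff hb]
  constructor
  · intro h
    by_contra h0
    have := excess_nonneg (x ++ [1])
    obtain ⟨y, z, h1, h2⟩ := exists_isLastUnpairedTwo hb (by omega)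
    rcases z with _ | ⟨a, z⟩
    · simpa using (List.append_inj' h1 rfl).2
    · rw [h1] at hb
      have h3 : a = 1 ∨ a = 2 := by
        simp at hb
        exact hb.2.1
      rcases h3 with rfl | rfl
      · have := h y z h1
        have := excess_nonneg y
        have := h2.1
        omega
      · have h3 := h2.2
        have := excess_nonneg z
        simp at h3
        omega
  · rintro h y s h1
    rw [h1] at h
    simp at h
    have := excess_nonneg s
    omega

theorem isBoundary_phi {x : Word} (hx : IsBinary x) : IsBoundary (phi (x ++ [2, 1])) :=
  Or.inr ⟨phi x, isBinary_phi hx, phi_concat_two_one hx⟩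

theorem bijOn_phi_RLe : Set.BijOn phi (B [2, 1]) (boundaryWord '' RLe (-1)) := by
  refine ⟨?_, phi.injective.injOn, ?_⟩
  · rintro v ⟨rfl | ⟨x, hx, rfl⟩, hb⟩
    · exact ⟨diagram (phi []), (diagram_phi_mem_RLe_neg_one_iff (Or.inl rfl)).2 rfl,
        boundaryWord_diagram (Or.inl rfl)⟩
    · refine ⟨diagram (phi (x ++ [2, 1])), ?_, boundaryWord_diagram (isBoundary_phi hx)⟩
      rw [diagram_phi_mem_RLe_neg_one_iff (Or.inr ⟨x ++ [2], by simp [hx], by simp⟩)]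
      exact (isBallot_iff (by simp [hx])).1 hb
  · rintro _ ⟨lam, hl, rfl⟩
    obtain h | ⟨y, hy, h⟩ := isBoundary_boundaryWord lam
    · rw [h]
      exact ⟨[], ⟨Or.inl rfl, (isBallot_iff (by simp)).2 rfl⟩, rfl⟩
    · obtain ⟨x, hx, rfl⟩ := exists_phi_eq hy
      rw [← phi_concat_two_one hx] at h
      refine ⟨x ++ [2, 1], ⟨Or.inr ⟨x, hx, rfl⟩, ?_⟩, h.symm⟩
      rw [isBallot_iff (by simp [hx]), ← diagram_phi_mem_RLe_neg_one_iff
        (Or.inr ⟨x ++ [2], by simp [hx], by simp⟩), ← h, diagram_boundaryWord]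
      exact hl

theorem maxRank_le_of_mem_RLe {lam : YoungDiagram} {t : ℤ} (h : lam ∈ RLe t) :
    maxRank lam ≤ t := by
  refine Finset.sup_le fun i hi => ?_
  rw [Finset.mem_Icc] at hi
  exact WithBot.coe_le_coe.2 (h i hi.1 hi.2)

/-- The maximal rank is first attained, from the left, at the rightmost unpaired two. -/
theorem maxRank_diagram_phi {y s : Word} (h : IsBinary (y ++ 2 :: 1 :: s))
    (hy : IsLastUnpairedTwo y (1 :: s)) :
    maxRank (diagram (phi (y ++ 2 :: 1 :: s))) = height y ∧
      maxRankIndex (diagram (phi (y ++ 2 :: 1 :: s))) = descents s + 1 := by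
  have hr := rank_diagram_phi h
  have hd := descents_succ_le_durfee h
  have h0 : maxRank (diagram (phi (y ++ 2 :: 1 :: s))) = height y := by
    apply le_antisymm
    · apply maxRank_le_of_mem_RLe
      rw [diagram_phi_mem_RLe_iff h]
      intro y' s' he
      have h1 := hy.excess_two
      rw [he] at h1
      simp at h1
      have := excess_nonneg s'
      omega
    · rw [← hr]
      exact Finset.le_sup (f := fun i => (rank _ i : WithBot ℤ))
        (Finset.mem_Icc.2 ⟨by omega, hd⟩)
  refine ⟨h0, ?_⟩
  rw [maxRankIndex, Nat.findGreatest_eq_iff, h0]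
  refine ⟨hd, fun _ => ⟨by omega, by rw [hr]⟩, ?_⟩
  rintro i hi hi' ⟨h1, h2⟩
  obtain ⟨y', s', he, rfl⟩ := exists_descent_of_le_durfee h h1 hi'
  rw [he] at h h2
  rw [rank_diagram_phi h] at h2
  have h2 := WithBot.coe_injective h2
  -- A descent further right has a smaller index. One further left preceded by the same height would
  -- make `y` exceed its final height.
  rcases List.append_eq_append_iff.1 he with ⟨p, h3, h4⟩ | ⟨p, h3, h4⟩
  · have : s' <:+ s := by
      have h5 : 1 :: s' <:+ 1 :: s := by
        rcases p with _ | ⟨a, p⟩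
        · simp at h4
          simp [h4]
        · exact ⟨p ++ [2], by simpa using (List.cons.inj h4).2.symm⟩
      rcases List.suffix_cons_iff.1 h5 with h5 | h5
      · exact (List.cons.inj h5).2 ▸ List.suffix_rfl
      · exact (List.suffix_cons _ _).trans h5
    obtain ⟨q, rfl⟩ := this
    have := descents_append_le q s'
    omega
  · rcases p with _ | ⟨a, p⟩
    · simp at h4
      obtain rfl := h4
      omega
    · obtain ⟨rfl, -⟩ := List.cons.inj h4
      have := hy.1
      rw [h3] at this h2
      simp at this h2
      have := excess_nonneg p
      omega

/-! ### The loop body -/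

/-- Compare with `φ(y21) = t 2 1`: changing the two after `y` to a one deletes the two after `t` and
puts a one before `t`. -/
theorem exists_phi_concat_one_one_eq {y : Word} (hy : IsBinary y)
    (h : y = [] ∨ ∃ y', y = y' ++ [2]) :
    ∃ t, 2 :: phi y = t ++ [2] ∧ phi (y ++ [1, 1]) = 1 :: t ++ [1] := by
  obtain rfl | ⟨y, rfl⟩ := h
  · exact ⟨[], by simp, phi_concat_one_one []⟩
  · have hy' := (isBinary_append.1 hy).1
    refine ⟨2 :: phi y, by rw [phi_concat_two hy']; rfl, ?_⟩
    rw [phi_concat_one_one, ← List.append_cons, phi_concat_two_one hy']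
    rfl

theorem descents_append_replicate_two (w : Word) (m : ℕ) :
    descents (w ++ List.replicate m 2) = descents w := by
  induction m with
  | zero => simp
  | succ m ih => rw [List.replicate_succ', ← List.append_assoc, descents_concat_two, ih]

theorem kappa_diagram_phi {x : Word} (hx : IsBinary x) (h0 : 0 < excess x) (m : ℕ)
    (he : excess (x ++ [1] ++ List.replicate (m + 1) 2 ++ [1]) = excess x) :
    0 ≤ maxRank (diagram (phi (x ++ [1] ++ List.replicate (m + 1) 2 ++ [1]))) ∧
      kappa (diagram (phi (x ++ [1] ++ List.replicate (m + 1) 2 ++ [1]))) =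
        some (diagram (phi (gamma x ++ [1] ++ List.replicate (m + 2) 2 ++ [1]))) := by
  have h12 : (1 : ℕ+) ≠ 2 := by decide
  obtain ⟨y, z, rfl, h1, hy, hz, hyz⟩ := gamma_spec hx h0
  rw [h1]
  obtain ⟨s, hs⟩ : ∃ s, z ++ [1] = 1 :: s := by
    rcases z with _ | ⟨a, z⟩
    · exact ⟨[], rfl⟩
    · obtain ⟨rfl | rfl, -⟩ := isBinary_cons.1 hz
      · exact ⟨_, rfl⟩
      · have h2 := hyz.2
        have := excess_nonneg z
        simp at h2
        omega
  have hsb : IsBinary s := by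
    have : IsBinary (z ++ [1]) := by simp [hz]
    rw [hs] at this
    exact (isBinary_cons.1 this).2
  have e1 : y ++ 2 :: z ++ [1] = y ++ [2, 1] ++ s := by simp [hs]
  have e2 : y ++ 1 :: z ++ [1] = y ++ [1, 1] ++ s := by simp [hs]
  have e3 : y ++ [2, 1] ++ s ++ List.replicate (m + 1) 2 ++ [1] =
      y ++ 2 :: 1 :: (s ++ List.replicate m 2 ++ [2, 1]) := by simp [List.replicate_succ']
  -- By `he` the suffix contributes no unpaired two, so the rightmost one of the whole word is still
  -- that of `x`.
  have hlast : IsLastUnpairedTwo y (1 :: (s ++ List.replicate m 2 ++ [2, 1])) := by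
    refine ⟨hyz.1, ?_⟩
    rw [hyz.excess_two, e1, e3, excess_append, excess_two_cons] at he
    have := excess_nonneg (1 :: (s ++ List.replicate m 2 ++ [2, 1]))
    omega
  have hb : IsBinary (y ++ 2 :: 1 :: (s ++ List.replicate m 2 ++ [2, 1])) := by simp [hy, hsb]
  obtain ⟨hmax, hind⟩ := maxRank_diagram_phi hb hlast
  obtain ⟨l, r, hl, hr, -, -, hphi⟩ := exists_phi_append hsb
  obtain ⟨t, ht, ht'⟩ := exists_phi_concat_one_one_eq hy (hlast.eq_nil_or_two hy)
  -- The next two normal forms differ by the edits of `kappa`: the two after `2 l t` is a column of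
  -- size `i`, the one inserted after `2 l` is a row of size `i - 1`, and the two before the final
  -- one lengthens the first row.
  have hphi1 : phi (y ++ 2 :: 1 :: (s ++ List.replicate m 2 ++ [2, 1])) =
      (2 :: l ++ t) ++ 2 :: (1 :: r ++ List.replicate m 2 ++ [1]) := by
    have e4 : y ++ 2 :: 1 :: (s ++ List.replicate m 2 ++ [2, 1]) =
      y ++ [2, 1] ++ s ++ List.replicate m 2 ++ [2, 1] := by simp
    rw [e4, phi_concat_two_one (by simp [hy, hsb]), phi_append_replicate_two (by simp [hy, hsb]),
      hphi _ (by simp [hy]) (Or.inr ⟨y ++ [2], by simp⟩), phi_concat_two_one hy, ht]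
    simp
  have hphi2 : phi (y ++ [1, 1] ++ s ++ List.replicate (m + 2) 2 ++ [1]) =
      (2 :: l) ++ 1 :: (t ++ (1 :: r ++ List.replicate m 2)) ++ [2, 1] := by
    have e4 : y ++ [1, 1] ++ s ++ List.replicate (m + 2) 2 ++ [1] =
      y ++ [1, 1] ++ s ++ List.replicate (m + 1) 2 ++ [2, 1] := by simp [List.replicate_succ']
    rw [e4, phi_concat_two_one (by simp [hy, hsb]), phi_append_replicate_two (by simp [hy, hsb]),
      hphi _ (by simp [hy]) (Or.inr ⟨y ++ [1], by simp⟩), ht', List.replicate_succ']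
    simp
  rw [e1, e2, e3, hmax]
  refine ⟨?_, ?_⟩
  · have := hlast.1
    have := excess_nonneg y
    exact WithBot.coe_le_coe.2 (by omega)
  -- The final `21` adds a descent, so here `i = descents s + 2`.
  · have hdes : descents (s ++ List.replicate m 2 ++ [2, 1]) = descents s + 1 := by
      rw [descents_concat_two_one, descents_append_replicate_two]
    have hcount : descents s + 1 + 1 =
        (1 :: r ++ List.replicate m 2 ++ [1] : Word).count 1 := by
      simp [hr, List.count_replicate, h12.symm]
    have hcount' : descents s + 1 = (2 :: l : Word).count 2 := by simp [hl]
    obtain ⟨h2, h3⟩ := removeConjPart_diagram (2 :: l ++ t)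
      (s := 1 :: r ++ List.replicate m 2 ++ [1]) (by omega)
    rw [← hphi1, ← hcount] at h2 h3
    simp only [kappa, hind, hdes]
    rw [if_pos h2, h3, Nat.add_sub_cancel, hcount', List.append_assoc, addPart_diagram, hphi2,
      ← growFirst_diagram]
    simp

/-! ### The algorithm -/

/-- Each step lowers the height of the first factor by two and adds only one two at the end, so the
final run stays paired. -/
theorem gammaBar_iterate_spec {x : Word} (hx : IsBinary x) {j : ℕ} (hj : j ≤ excess x) :
    IsBinary (gamma^[j] x) ∧ excess (gamma^[j] x) = excess x - j ∧
      excess (gamma^[j] x ++ [1] ++ List.replicate (j + 1) 2 ++ [1]) = excess x - j := by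
  obtain ⟨h1, h2, h3⟩ := gamma_iterate hx j hj
  have := height_le_excess x
  refine ⟨h1, h2, ?_⟩
  simp
  omega

theorem kappa_gammaBar_iterate {x : Word} (hx : IsBinary x) {j : ℕ} (hj : j < excess x) :
    0 ≤ maxRank (diagram (phi (gammaBar^[j] (x ++ [1, 2, 1])))) ∧
      kappa (diagram (phi (gammaBar^[j] (x ++ [1, 2, 1])))) =
        some (diagram (phi (gammaBar^[j + 1] (x ++ [1, 2, 1])))) := by
  obtain ⟨h1, h2, h3⟩ := gammaBar_iterate_spec hx hj.le
  rw [gammaBar_iterate, gammaBar_iterate, Function.iterate_succ_apply']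
  exact kappa_diagram_phi h1 (by omega) j (by omega)

theorem isBoundary_phi_gammaBar_iterate {x : Word} (hx : IsBinary x) {j : ℕ}
    (hj : j ≤ excess x) : IsBoundary (phi (gammaBar^[j] (x ++ [1, 2, 1]))) := by
  have h1 := (gamma_iterate hx j hj).1
  have h2 := isBoundary_phi (x := gamma^[j] x ++ [1] ++ List.replicate j 2) (by simp [h1])
  rw [gammaBar_iterate, List.replicate_succ']
  simpa using h2

theorem mem_CSV_iff {lam mu : YoungDiagram} : mu ∈ CSV lam ↔
    Sum.inl mu ∈ csvStep lam ∨ ∃ nu, Sum.inr nu ∈ csvStep lam ∧ mu ∈ CSV nu :=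
  PFun.mem_fix_iff

theorem CSV_eq_of_mem_RLe {lam : YoungDiagram} (h : lam ∈ RLe (-1)) :
    CSV lam = Part.some lam := by
  have h1 : ¬ 0 ≤ maxRank lam := by
    intro h0
    have := WithBot.coe_le_coe.1 (h0.trans (maxRank_le_of_mem_RLe h))
    omega
  rw [Part.eq_some_iff, mem_CSV_iff]
  left
  simp [csvStep, h1]

theorem CSV_eq_of_kappa_eq {lam mu : YoungDiagram} (h : 0 ≤ maxRank lam)
    (hk : kappa lam = some mu) {nu : YoungDiagram} (hc : CSV mu = Part.some nu) :
    CSV lam = Part.some nu := by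
  rw [Part.eq_some_iff, mem_CSV_iff]
  right
  refine ⟨mu, by simp [csvStep, h, hk], ?_⟩
  rw [hc]
  exact Part.mem_some _

theorem CSV_diagram_phi {v : Word} (hv : v ∈ W [1, 2, 1]) :
    CSV (diagram (phi v)) = Part.some (diagram (phi (GK v))) := by
  obtain rfl | ⟨x, hx, rfl⟩ := hv
  · exact CSV_eq_of_mem_RLe ((diagram_phi_mem_RLe_neg_one_iff (Or.inl rfl)).2 rfl)
  obtain ⟨t, ht⟩ := Int.eq_ofNat_of_zero_le (excess_nonneg x)
  rw [GK_eq hx ht, ← gammaBar_iterate]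
  -- Induction on the number `k` of remaining loop steps, since the output is known only at the end
  -- of the loop.
  have key : ∀ k j, j + k = t → CSV (diagram (phi (gammaBar^[j] (x ++ [1, 2, 1])))) =
      Part.some (diagram (phi (gammaBar^[t] (x ++ [1, 2, 1])))) := by
    intro k
    induction k with
    | zero =>
      rintro j rfl
      obtain ⟨h1, h2, h3⟩ := gammaBar_iterate_spec (j := j) hx (by omega)
      apply CSV_eq_of_mem_RLe
      rw [gammaBar_iterate, diagram_phi_mem_RLe_neg_one_iff
        (Or.inr ⟨gamma^[j] x ++ [1] ++ List.replicate (j + 1) 2, by simp [h1], rfl⟩)]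
      omega
    | succ k ih =>
      intro j hj
      obtain ⟨h1, h2⟩ := kappa_gammaBar_iterate (j := j) hx (by omega)
      exact CSV_eq_of_kappa_eq h1 h2 (ih (j + 1) (by omega))
  exact key t 0 (zero_add t)

end Mahonian

theorem mainTheorem1 :
    Function.Injective boundaryWord ∧
    Set.BijOn phi (W [1, 2, 1]) (boundaryWord '' D 0) ∧
    Set.BijOn phi (B [2, 1]) (boundaryWord '' RLe (-1)) ∧
    Set.BijOn GK (W [1, 2, 1]) (B [2, 1]) ∧
    (∃ csv : YoungDiagram → YoungDiagram,
      Set.BijOn csv (D 0) (RLe (-1)) ∧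
      ∀ lam ∈ D 0, CSV lam = Part.some (csv lam) ∧
        boundaryWord (csv lam) = phi (GK (phi.symm (boundaryWord lam)))) ∧
    (∀ v ∈ W [1, 2, 1], ∀ j < (unpairedTwos v).length, ∃ mu nu : YoungDiagram,
      phi.symm (boundaryWord mu) = gammaBar^[j] v ∧
      0 ≤ maxRank mu ∧
      kappa mu = some nu ∧
      boundaryWord nu = phi (gammaBar (phi.symm (boundaryWord mu)))) := by
  refine ⟨boundaryWord_injective, bijOn_phi_D, bijOn_phi_RLe, bijOn_GK,
    ⟨fun lam => diagram (phi (GK (phi.symm (boundaryWord lam)))), ?_, ?_⟩, ?_⟩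
  · have h1 : Set.BijOn boundaryWord (D 0) (boundaryWord '' D 0) :=
      boundaryWord_injective.injOn.bijOn_image
    have h2 : Set.BijOn phi.symm (boundaryWord '' D 0) (W [1, 2, 1]) :=
      bijOn_phi_D.symm ⟨fun v _ => phi.apply_symm_apply v, fun v _ => phi.symm_apply_apply v⟩
    have h3 : Set.BijOn diagram (boundaryWord '' RLe (-1)) (RLe (-1)) := by
      refine boundaryWord_injective.injOn.bijOn_image.symm ⟨?_, ?_⟩
      · rintro _ ⟨lam, -, rfl⟩
        rw [diagram_boundaryWord]
      · exact fun lam _ => diagram_boundaryWord lam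
    exact h3.comp (bijOn_phi_RLe.comp (bijOn_GK.comp (h2.comp h1)))
  · intro lam hl
    obtain ⟨v, hv, h1⟩ := bijOn_phi_D.surjOn ⟨lam, hl, rfl⟩
    have h2 := CSV_diagram_phi hv
    obtain ⟨mu, -, h3⟩ := bijOn_phi_RLe.mapsTo (bijOn_GK.mapsTo hv)
    rw [h1, diagram_boundaryWord] at h2
    simp only [← h1, Equiv.symm_apply_apply]
    exact ⟨h2, by rw [← h3, diagram_boundaryWord]⟩
  · rintro v (rfl | ⟨x, hx, rfl⟩) j hj
    · simp [unpairedTwos, unpaired] at hj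
    · have hj' : (j : ℤ) < excess x := by
        rw [← length_unpairedTwos_append hx]
        exact_mod_cast hj
      obtain ⟨h1, h2⟩ := kappa_gammaBar_iterate hx hj'
      refine ⟨_, _, ?_, h1, h2, ?_⟩
      · rw [boundaryWord_diagram (isBoundary_phi_gammaBar_iterate hx hj'.le),
          Equiv.symm_apply_apply]
      · rw [boundaryWord_diagram (isBoundary_phi_gammaBar_iterate hx hj'.le),
          boundaryWord_diagram (isBoundary_phi_gammaBar_iterate hx (by push_cast; omega)),
          Equiv.symm_apply_apply, Function.iterate_succ_apply']
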